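/- Let $\mathcal O$ be a complete discrete valuation ring with residue field $k=\mathcal O/\mathfrak m_{\mathcal O}$ of characteristic different from $2$, and let $\Pi$ be a finitely generated group. Let $\mathcal C$ be the category whose objects are the local $\mathcal O$-algebras $R$ with residue field $k$ that are complete (and separated) in the $\mathfrak m_R$-adic topology, and whose morphisms are the $\mathcal O$-algebra homomorphisms inducing the identity on the residue fields $k$. A map $T:\Pi\to A$ to a commutative ring $A$ is a pseudo-$\mathrm{SL}_2$-representation over $A$ if, for all $g,g_1,g_2,g_3\in\Pi$: $T(1)=2$; $T(g_1g_2)=T(g_2g_1)$; $T(g_1)T(g_2)T(g_3)+T(g_1g_2g_3)+T(g_1g_3g_2)-T(g_1g_2)T(g_3)-T(g_2g_3)T(g_1)-T(g_1g_3)T(g_2)=0$; and $T(g)^2-T(g^2)=2$. A deformation of a pseudo-$\mathrm{SL}_2$-representation $\overline T:\Pi\to k$ is a pair $(R,T)$ with $R\in\mathcal C$ and $T$ a pseudo-$\mathrm{SL}_2$-representation over $R$ such that $T \bmod \mathfrak m_R=\overline T$; it is universal if for every deformation $(R',T')$ of $\overline T$ there is a unique morphism $\psi:R\to R'$ in $\mathcal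 C$ with $\psi\circ T=T'$. A deformation of a representation $\overline\rho:\Pi\to\mathrm{SL}_2(k)$ is a pair $(R,\rho)$ with $R\in\mathcal C$ and $\rho:\Pi\to\mathrm{SL}_2(R)$ a homomorphism such that $\rho\bmod\mathfrak m_R=\overline\rho$. Two homomorphisms $\rho,\rho':\Pi\to\mathrm{SL}_2(R)$ are strictly equivalent, $\rho\approx\rho'$, if there is $\gamma\in I_2+\mathrm M_2(\mathfrak m_R)$ with $\rho'(g)=\gamma^{-1}\rho(g)\gamma$ for all $g\in\Pi$. A deformation $(R,\rho)$ of $\overline\rho$ is universal if for every deformation $(R',\rho')$ of $\overline\rho$ there is a unique morphism $\psi:R\to R'$ in $\mathcal C$ with $\psi\circ\rho\approx\rho'$. **Theorem.** Let $\overline\rho:\Pi\to\mathrm{SL}_2(k)$ be absolutely irreducible, i.e. irreducible over an algebraic closure of $k$. Then $\overline T:=\operatorname{tr}(\overline\rho)$ is a pseudo-$\mathrm{SL}_2$-representation over $k$, and there exists a universal deformation of $\overline\rho$. Moreover the universal deformation ring of $\overline\rho$ is that of $\overline T$: if $(R,\rho)$ is a universal deformation of $\overline\rho$, then $(R,\operatorname{tr}(\rho))$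 is a universal deformation of $\overline T$; and conversely, if $(R,T)$ is a universal deformation of $\overline T$, then there is a homomorphism $\rho:\Pi\to\mathrm{SL}_2(R)$ with $\operatorname{tr}(\rho)=T$ such that $(R,\rho)$ is a universal deformation of $\overline\rho$. -/

import Mathlib

open IsLocalRing

universe u v w w' p

/-- A map `T` from a group to a commutative ring `A` is a pseudo-`SL₂`-representation over `A`. -/
structure IsPseudoSL2Rep {P : Type p} [Group P] {A : Type w} [CommRing A] (T : P → A) : Prop where
  map_one : T 1 = 2
  map_mul_comm : ∀ g₁ g₂ : P, T (g₁ * g₂) = T (g₂ * g₁)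
  triple : ∀ g₁ g₂ g₃ : P,
    T g₁ * T g₂ * T g₃ + T (g₁ * g₂ * g₃) + T (g₁ * g₃ * g₂)
      - T (g₁ * g₂) * T g₃ - T (g₂ * g₃) * T g₁ - T (g₁ * g₃) * T g₂ = 0
  sq_sub : ∀ g : P, T g ^ 2 - T (g ^ 2) = 2

/-- The trace (character) of a representation into `SL₂(A)`. -/
def sl2Trace {P : Type p} [Group P] {A : Type w} [CommRing A]
    (ρ : P →* Matrix.SpecialLinearGroup (Fin 2) A) : P → A :=
  fun g => Matrix.trace (ρ g : Matrix (Fin 2) (Fin 2) A)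

/-- The representation on column vectors `A²` given by a homomorphism into `SL₂(A)`. -/
noncomputable def sl2StdRep {P : Type p} [Group P] {A : Type w} [CommRing A]
    (ρ : P →* Matrix.SpecialLinearGroup (Fin 2) A) : Representation A P (Fin 2 → A) where
  toFun g := Matrix.toLin' (ρ g : Matrix (Fin 2) (Fin 2) A)
  map_one' := by simp [Module.End.one_eq_id]
  map_mul' g h := by simp [Matrix.toLin'_mul, Module.End.mul_eq_comp]

/-- `ρ` is absolutely irreducible: it becomes an irreducible representation over an algebraic
closure of the field `k`. -/
def IsAbsolutelyIrreducibleSL2 {P : Type p} [Group P] {k : Type v} [Field k]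
    (ρ : P →* Matrix.SpecialLinearGroup (Fin 2) k) : Prop :=
  (sl2StdRep
    ((Matrix.SpecialLinearGroup.map (algebraMap k (AlgebraicClosure k))).comp ρ)).IsIrreducible

/-- Strict equivalence of representations over a local ring: conjugacy by a matrix which is
congruent to the identity modulo the maximal ideal. -/
def SL2StrictEquiv {P : Type p} [Group P] {A : Type w} [CommRing A] [IsLocalRing A]
    (ρ ρ' : P →* Matrix.SpecialLinearGroup (Fin 2) A) : Prop :=
  ∃ γ : GL (Fin 2) A,
    (∀ i j, (γ : Matrix (Fin 2) (Fin 2) A) i j - (1 : Matrix (Fin 2) (Fin 2) A) i j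
      ∈ maximalIdeal A) ∧
    ∀ g : P, (ρ' g : Matrix (Fin 2) (Fin 2) A) =
      ((γ⁻¹ : GL (Fin 2) A) : Matrix (Fin 2) (Fin 2) A) * (ρ g : Matrix (Fin 2) (Fin 2) A) *
        (γ : Matrix (Fin 2) (Fin 2) A)

/-- An object of the category of complete local `O`-algebras with residue field `k`: a local
`O`-algebra, complete and separated for the topology of its maximal ideal, with a surjective
`O`-algebra homomorphism onto the field `k`. The kernel of the latter is the maximal ideal, so
that it identifies the residue field with `k`. -/
structure CompleteLocalAlg (O : Type u) (k : Type v) [CommRing O] [Field k] [Algebra O k] where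
  carrier : Type w
  [commRing : CommRing carrier]
  [algebra : Algebra O carrier]
  [isLocalRing : IsLocalRing carrier]
  [isAdicComplete : IsAdicComplete (maximalIdeal carrier) carrier]
  residue : carrier →ₐ[O] k
  residue_surjective : Function.Surjective residue

namespace CompleteLocalAlg

variable {O : Type u} {k : Type v} [CommRing O] [Field k] [Algebra O k]

instance : CoeSort (CompleteLocalAlg.{u, v, w} O k) (Type w) := ⟨carrier⟩

instance (R : CompleteLocalAlg.{u, v, w} O k) : CommRing R := R.commRing

instance (R : CompleteLocalAlg.{u, v, w} O k) : Algebra O R := R.algebra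

instance (R : CompleteLocalAlg.{u, v, w} O k) : IsLocalRing R := R.isLocalRing

instance (R : CompleteLocalAlg.{u, v, w} O k) : IsAdicComplete (maximalIdeal R) R :=
  R.isAdicComplete

/-- Morphisms: `O`-algebra homomorphisms which induce the identity on the residue field `k`. -/
def Hom (R : CompleteLocalAlg.{u, v, w} O k)
    (S : CompleteLocalAlg.{u, v, w'} O k) : Type (max w w') :=
  {ψ : R →ₐ[O] S // S.residue.comp ψ = R.residue}

end CompleteLocalAlg

section Deformations

variable {O : Type u} {k : Type v} [CommRing O] [Field k] [Algebra O k] {P : Type p} [Group P]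

/-- `(R, T)` is a deformation of the pseudo-`SL₂`-representation `Tbar` over `k`. -/
def IsPseudoDeformation (Tbar : P → k) (R : CompleteLocalAlg.{u, v, w} O k) (T : P → R) : Prop :=
  IsPseudoSL2Rep T ∧ ∀ g, R.residue (T g) = Tbar g

/-- `(R, T)` is a universal deformation of `Tbar`; the universal property is tested against
complete local algebras in the universe `Type w'`. -/
def IsUniversalPseudoDeformation (Tbar : P → k) (R : CompleteLocalAlg.{u, v, w} O k)
    (T : P → R) : Prop :=
  IsPseudoDeformation Tbar R T ∧
    ∀ (S : CompleteLocalAlg.{u, v, w'} O k) (T' : P → S), IsPseudoDeformation Tbar S T' →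
      ∃! ψ : R.Hom S, ∀ g, ψ.1 (T g) = T' g

/-- `(R, ρ)` is a deformation of `ρbar : P → SL₂(k)`. -/
def IsSL2Deformation (ρbar : P →* Matrix.SpecialLinearGroup (Fin 2) k)
    (R : CompleteLocalAlg.{u, v, w} O k) (ρ : P →* Matrix.SpecialLinearGroup (Fin 2) R) : Prop :=
  (Matrix.SpecialLinearGroup.map (R.residue : R →+* k)).comp ρ = ρbar

/-- `(R, ρ)` is a universal deformation of `ρbar`, up to strict equivalence; the universal
property is tested against complete local algebras in the universe `Type w'`. -/
def IsUniversalSL2Deformation (ρbar : P →* Matrix.SpecialLinearGroup (Fin 2) k)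
    (R : CompleteLocalAlg.{u, v, w} O k) (ρ : P →* Matrix.SpecialLinearGroup (Fin 2) R) : Prop :=
  IsSL2Deformation ρbar R ρ ∧
    ∀ (S : CompleteLocalAlg.{u, v, w'} O k) (ρ' : P →* Matrix.SpecialLinearGroup (Fin 2) S),
      IsSL2Deformation ρbar S ρ' →
        ∃! ψ : R.Hom S,
          SL2StrictEquiv ((Matrix.SpecialLinearGroup.map (ψ.1 : R →+* S)).comp ρ) ρ'

end Deformations

/-! Over a complete local ring, taking traces identifies strict equivalence classes of deformations
of `ρbar` with deformations of its trace. Both universal properties then say the same thing, and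
existence only has to be proved for pseudo-representations.

The bridge is a pair `g`, `h` in the group. Absolute irreducibility gives `g` with distinct
eigenvalues and `h` such that the commutator of their images is invertible
(`IsAbsolutelyIrreducibleSL2.exists_generic_pair`). The traceless part `i` of `g` and the commutator
`j` of `g` and `h` anticommute. Their squares are scalars computed from the trace, and these scalars
are units because they are nonzero in `k`. Hence `1, i, j, ij` is a quaternion basis, in which every
group element has coefficients depending on the trace only.

Injectivity (`sl2StrictEquiv_of_sl2Trace_eq`): two lifts with the same trace are intertwined by an
average over the two quaternion bases, which is the identity modulo the maximal ideal after scaling.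
Surjectivity (`IsPseudoSL2Rep.exists_lift`): the group algebra modulo the radical of the trace form
is a quaternion algebra, and lifting the residual `i`, `j` to anticommuting matrices, by Hensel's
lemma, maps it to `2 × 2` matrices.

Existence: generators and relations give a universal ring of pseudo-representations over `O`. It is
of finite type because the group is finitely generated (`IsPseudoSL2Rep.exists_finset_adjoin`),
hence Noetherian, and its completion at the point given by the residual trace is the universal
deformation ring. -/

/-! ### Identities satisfied by pseudo-representations -/

section Identities

variable {P : Type p} [Group P] {A : Type w} [CommRing A] {T : P → A}

namespace IsPseudoSL2Rep

theorem map_mul_mul_rotate (hT : IsPseudoSL2Rep T) (a b c : P) : T (a * b * c) = T (c * a * b) := by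
  rw [hT.map_mul_comm, mul_assoc]

/-- The Cayley–Hamilton identity `a² - T(a) a + 1 = 0`, paired with `b`. -/
theorem map_self_mul_mul (hT : IsPseudoSL2Rep T) (h2 : IsUnit (2 : A)) (a b : P) :
    T (a * a * b) = T a * T (a * b) - T b := by
  have h := hT.triple a a b
  have h' := hT.sq_sub a
  have h'' : T (a * b * a) = T (a * a * b) := hT.map_mul_mul_rotate a b a
  rw [pow_two a] at h'
  -- The triple relation at `(a, a, b)` is twice the desired identity once `T (a * a)` is
  -- eliminated.
  apply h2.mul_left_cancel
  linear_combination h - h'' - T b * h'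

theorem map_inv_mul (hT : IsPseudoSL2Rep T) (h2 : IsUnit (2 : A)) (a b : P) :
    T (a⁻¹ * b) = T a * T b - T (a * b) := by
  have h := hT.map_self_mul_mul h2 a (a⁻¹ * b)
  rw [mul_inv_cancel_left, show a * a * (a⁻¹ * b) = a * b by group] at h
  linear_combination h

theorem map {B : Type*} [CommRing B] (hT : IsPseudoSL2Rep T) (f : A →+* B) :
    IsPseudoSL2Rep fun g => f (T g) where
  map_one := by rw [hT.map_one, map_ofNat]
  map_mul_comm g₁ g₂ := by rw [hT.map_mul_comm]
  triple g₁ g₂ g₃ := by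
    simpa only [map_sub, map_add, map_mul, map_zero] using congrArg f (hT.triple g₁ g₂ g₃)
  sq_sub g := by rw [← map_pow, ← map_sub, hT.sq_sub, map_ofNat]

end IsPseudoSL2Rep

end Identities

/-! ### Finite generation of the ring of trace values -/

section FiniteGeneration

variable {P : Type p} [Group P] {A : Type w} [CommRing A]

/-- The products of the sublists of a list. -/
def sublistProds : List P → List P
  | [] => [1]
  | s :: l => sublistProds l ++ (sublistProds l).map (s * ·)

theorem one_mem_sublistProds (l : List P) : 1 ∈ sublistProds l := by
  induction l with
  | nil => simp [sublistProds]
  | cons s l ih => simp [sublistProds, ih]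

variable {O : Type u} [CommRing O] [Algebra O A] (C : Subalgebra O A)

/-- Right translation of functions on a group. -/
def rightTranslate (s : P) : (P → A) →ₗ[C] (P → A) where
  toFun f g := f (g * s)
  map_add' _ _ := rfl
  map_smul' _ _ := rfl

/-- The span of the left translates of `T` by the products of the sublists of `l`. -/
def translateSpan (T : P → A) (l : List P) : Submodule C (P → A) :=
  Submodule.span C ((fun x g => T (x * g)) '' {x | x ∈ sublistProds l})

variable {C} {T : P → A}

/-- By cyclicity of `T`, right translation of a function acts as left multiplication on the index of
a left translate. -/
theorem IsPseudoSL2Rep.rightTranslate_apply (hT : IsPseudoSL2Rep T) (s x : P) :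
    rightTranslate C s (fun g => T (x * g)) = fun g => T (s * x * g) := by
  funext g
  change T (x * (g * s)) = _
  rw [← mul_assoc, hT.map_mul_mul_rotate]

theorem translateSpan_cons_le (s : P) (l : List P) :
    translateSpan C T l ≤ translateSpan C T (s :: l) := by
  apply Submodule.span_mono
  apply Set.image_mono
  intro x hx
  simp only [Set.mem_ofPred_eq] at hx ⊢
  simp [sublistProds, hx]

theorem IsPseudoSL2Rep.rightTranslate_mem_cons (hT : IsPseudoSL2Rep T) (s : P) (l : List P)
    {f : P → A} (hf : f ∈ translateSpan C T l) :
    rightTranslate C s f ∈ translateSpan C T (s :: l) := by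
  induction hf using Submodule.span_induction with
  | mem f hf =>
    obtain ⟨x, hx, rfl⟩ := hf
    simp only [hT.rightTranslate_apply]
    refine Submodule.subset_span ⟨s * x, ?_, rfl⟩
    simp only [Set.mem_ofPred_eq] at hx ⊢
    simp [sublistProds, hx]
  | zero => simp
  | add f g _ _ h₁ h₂ => rw [map_add]; exact add_mem h₁ h₂
  | smul c f _ h => rw [map_smul]; exact Submodule.smul_mem _ _ h

/-- A straightening argument by induction on `l`: a repeated letter `s * s` is shortened by
Cayley–Hamilton, and two letters in the wrong order are exchanged by its polarization. The
coefficients involve only traces of letters and of products of two letters. -/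
theorem IsPseudoSL2Rep.rightTranslate_mem (hT : IsPseudoSL2Rep T) (h2 : IsUnit (2 : A))
    (l : List P) (h₁ : ∀ s ∈ l, T s ∈ C) (h₂ : ∀ s ∈ l, ∀ s' ∈ l, T (s * s') ∈ C) (s : P)
    (hs : s ∈ l) {f : P → A} (hf : f ∈ translateSpan C T l) :
    rightTranslate C s f ∈ translateSpan C T l := by
  induction l generalizing s f with
  | nil => simp at hs
  | cons a l ih =>
    have ih' : ∀ s ∈ l, ∀ f ∈ translateSpan C T l, rightTranslate C s f ∈ translateSpan C T l :=
      fun s hs f hf => ih (fun s hs => h₁ s (by simp [hs]))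
        (fun s hs s' hs' => h₂ s (by simp [hs]) s' (by simp [hs'])) s hs hf
    induction hf using Submodule.span_induction with
    | zero => simp
    | add f g _ _ h₁ h₂ => rw [map_add]; exact add_mem h₁ h₂
    | smul c f _ h => rw [map_smul]; exact Submodule.smul_mem _ _ h
    | mem f hf =>
      obtain ⟨x, hx, rfl⟩ := hf
      simp only [sublistProds, List.mem_append, List.mem_map, Set.mem_ofPred_eq] at hx
      have key : ∀ y, y ∈ sublistProds l → (fun g => T (y * g)) ∈ translateSpan C T l :=
        fun y hy => Submodule.subset_span ⟨y, hy, rfl⟩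
      rw [List.mem_cons] at hs
      rcases hx with hx | ⟨y, hy, rfl⟩
      · rcases hs with rfl | hs
        · exact hT.rightTranslate_mem_cons s l (key x hx)
        · exact translateSpan_cons_le a l (ih' s hs _ (key x hx))
      · have hy' := key y hy
        have hay : (fun g => T (a * y * g)) ∈ translateSpan C T (a :: l) := by
          rw [← hT.rightTranslate_apply (C := C)]
          exact hT.rightTranslate_mem_cons a l hy'
        rcases hs with rfl | hs
        · rw [hT.rightTranslate_apply]
          have : (fun g => T (s * (s * y) * g)) =
              (⟨T s, h₁ s (by simp)⟩ : C) • (fun g => T (s * y * g)) - fun g => T (y * g) := by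
            funext g
            have := hT.map_self_mul_mul h2 s (y * g)
            simp only [← mul_assoc] at this
            simpa [← mul_assoc, Subalgebra.smul_def] using this
          rw [this]
          exact sub_mem (Submodule.smul_mem _ _ hay) (translateSpan_cons_le _ _ hy')
        · have hsy := ih' s hs _ hy'
          rw [hT.rightTranslate_apply] at hsy ⊢
          have hasy : (fun g => T (a * (s * y) * g)) ∈ translateSpan C T (a :: l) := by
            rw [← hT.rightTranslate_apply (C := C)]
            exact hT.rightTranslate_mem_cons a l hsy
          -- The polarized identity exchanges `s` and `a`. The induction hypothesis then treats `s *
          -- y` before `a` is put in front.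
          have : (fun g => T (s * (a * y) * g)) =
              (⟨T s, h₁ s (by simp [hs])⟩ : C) • (fun g => T (a * y * g))
              + (⟨T a, h₁ a (by simp)⟩ : C) • (fun g => T (s * y * g))
              + (⟨T (a * s), h₂ a (by simp) s (by simp [hs])⟩ : C) • (fun g => T (y * g))
              - ((⟨T a, h₁ a (by simp)⟩ : C) * ⟨T s, h₁ s (by simp [hs])⟩) • (fun g => T (y * g))
              - fun g => T (a * (s * y) * g) := by
            funext g
            have h := hT.triple a s (y * g)
            rw [hT.map_mul_mul_rotate a (y * g) s] at h
            simp only [← mul_assoc] at h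
            simp only [← mul_assoc, Pi.sub_apply, Pi.add_apply, Pi.smul_apply, Subalgebra.smul_def,
              smul_eq_mul, MulMemClass.mk_mul_mk]
            linear_combination h
          rw [this]
          exact sub_mem (sub_mem (add_mem (add_mem (Submodule.smul_mem _ _ hay)
            (Submodule.smul_mem _ _ (translateSpan_cons_le _ _ hsy)))
            (Submodule.smul_mem _ _ (translateSpan_cons_le _ _ hy')))
            (Submodule.smul_mem _ _ (translateSpan_cons_le _ _ hy'))) hasy

/-- The values of a pseudo-`SL₂`-representation of a finitely generated group lie in a finitely
generated subalgebra. -/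
theorem IsPseudoSL2Rep.exists_finset_adjoin [Group.FG P] (hT : IsPseudoSL2Rep T)
    (h2 : IsUnit (2 : A)) : ∃ F : Set A, F.Finite ∧ ∀ g, T g ∈ Algebra.adjoin O F := by
  classical
  obtain ⟨S, hS⟩ := Group.FG.out (G := P)
  let l := S.toList
  -- The first two sets supply the straightening coefficients, the third the values at `1` of the
  -- spanning functions.
  let F : Set A := T '' {x | x ∈ l} ∪ (Set.image2 (fun x y => T (x * y)) {x | x ∈ l} {x | x ∈ l})
    ∪ T '' {x | x ∈ sublistProds l}
  refine ⟨F, ?_, fun g => ?_⟩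
  · have hl (l : List P) : {x | x ∈ l}.Finite := List.finite_toSet l
    exact (((hl _).image _).union ((hl _).image2 _ (hl _))).union ((hl _).image _)
  let C := Algebra.adjoin O F
  have hF : F ⊆ C := Algebra.subset_adjoin
  have hs : ∀ s ∈ l, ∀ f ∈ translateSpan C T l, rightTranslate C s f ∈ translateSpan C T l :=
    fun s hs f hf => hT.rightTranslate_mem h2 l (fun s hs => hF (.inl (.inl ⟨s, hs, rfl⟩)))
      (fun s hs s' hs' => hF (.inl (.inr ⟨s, hs, s', hs', rfl⟩))) s hs hf
  have hg : (fun x => T (g * x)) ∈ translateSpan C T l := by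
    have hgS : g ∈ Subgroup.closure (S : Set P) := by rw [hS]; trivial
    induction hgS using Subgroup.closure_induction_left with
    | one => exact Submodule.subset_span ⟨1, one_mem_sublistProds l, rfl⟩
    | mul_left x hx y _ ih =>
      rw [← hT.rightTranslate_apply (C := C)]
      exact hs x (by simpa [l] using hx) _ ih
    | inv_mul_cancel x hx y _ ih =>
      have hx' : x ∈ l := by simpa [l] using hx
      have : (fun g => T (x⁻¹ * y * g)) = (⟨T x, hF (.inl (.inl ⟨x, hx', rfl⟩))⟩ : C) •
          (fun g => T (y * g)) - fun g => T (x * y * g) := by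
        funext g
        simpa [mul_assoc, Subalgebra.smul_def] using hT.map_inv_mul h2 x (y * g)
      rw [this]
      refine sub_mem (Submodule.smul_mem _ _ ih) ?_
      rw [← hT.rightTranslate_apply (C := C)]
      exact hs x hx' _ ih
  have hval : ∀ f ∈ translateSpan C T l, f 1 ∈ C := by
    intro f hf
    induction hf using Submodule.span_induction with
    | mem f hf =>
      obtain ⟨x, hx, rfl⟩ := hf
      simp only [mul_one]
      exact hF (.inr ⟨x, hx, rfl⟩)
    | zero => exact zero_mem C
    | add f g _ _ h₁ h₂ => exact add_mem h₁ h₂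
    | smul c f _ h => exact mul_mem c.2 h
  simpa using hval _ hg

end FiniteGeneration

/-! ### Cayley–Hamilton algebras and quaternion bases -/

/-- A Cayley–Hamilton algebra of degree two: an algebra with a trace satisfying the polarized
Cayley–Hamilton identity. -/
structure IsCayleyHamilton {S : Type*} {E : Type*} [CommRing S] [Ring E] [Algebra S E]
    (t : E →ₗ[S] S) : Prop where
  map_one : t 1 = 2
  map_mul_comm : ∀ x y, t (x * y) = t (y * x)
  polar : ∀ x y, x * y + y * x = t x • y + t y • x + (t (x * y) - t x * t y) • 1

namespace IsCayleyHamilton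

variable {S : Type*} {E : Type*} [CommRing S] [Ring E] [Algebra S E] {t : E →ₗ[S] S}

theorem sq_of_trace_eq_zero (ht : IsCayleyHamilton t) (h2 : IsUnit (2 : S)) {x : E} (hx : t x = 0)
    {a : S} (ha : 2 * a = t (x * x)) : x * x = a • 1 := by
  have h := ht.polar x x
  rw [hx, ← ha] at h
  have : (2 : S) • (x * x) = (2 : S) • (a • (1 : E)) := by
    rw [two_smul, h, smul_smul]; simp
  exact h2.smul_left_cancel.mp this

/-- The trace of `j * i * j` is `c * t i` by cyclicity and its negative by anticommutation. -/
theorem trace_eq_zero_of_anticomm (ht : IsCayleyHamilton t) (h2 : IsUnit (2 : S)) {i j : E} {c : S}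
    (hc : IsUnit c) (hj : j * j = c • 1) (hij : i * j = -(j * i)) : t i = 0 := by
  have h1 : t (j * (i * j)) = c * t i := by
    rw [ht.map_mul_comm, mul_assoc, hj]; simp
  have h3 : t (j * (i * j)) = -(c * t i) := by
    rw [hij, mul_neg, ← mul_assoc, hj]; simp
  apply (h2.mul hc).mul_left_cancel
  linear_combination h1.symm.trans h3

/-- The expansion of an element in the quaternion basis `1, i, j, ij`. -/
theorem expansion (ht : IsCayleyHamilton t) (h2 : IsUnit (2 : S)) {i j : E} {a c : S}
    (ha : IsUnit a) (hc : IsUnit c)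
    (hi : i * i = a • 1) (hj : j * j = c • 1) (hij : i * j = -(j * i)) (x : E) :
    (2 * a * c) • x = (a * c * t x) • (1 : E) + (c * t (x * i)) • i + (a * t (x * j)) • j
      - t (x * (i * j)) • (i * j) := by
  have hti : t i = 0 := ht.trace_eq_zero_of_anticomm h2 hc hj hij
  have htj : t j = 0 := ht.trace_eq_zero_of_anticomm h2 ha hi (by rw [hij, neg_neg])
  have htk : t (i * j) = 0 := by
    have h : t (i * j) = - t (i * j) := by
      conv_lhs => rw [hij, map_neg, ht.map_mul_comm]
    apply h2.mul_left_cancel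
    linear_combination h
  have conj : ∀ (y : E) (d : S), t y = 0 → y * y = d • 1 →
      y * x * y = (d * t x) • 1 + t (x * y) • y - d • x := by
    intro y d hy hyy
    have h := congrArg (y * ·) (ht.polar x y)
    simp only [hy, mul_add, zero_smul, mul_zero, sub_zero, add_zero, mul_smul_comm, mul_one,
      ← mul_assoc, hyy, smul_mul_assoc, one_mul, smul_smul] at h
    rw [eq_sub_iff_add_eq, h, mul_comm (t x)]
  have hkk : (i * j) * (i * j) = (-(a * c)) • 1 := by
    calc (i * j) * (i * j) = i * (j * i) * j := by noncomm_ring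
      _ = -((i * i) * (j * j)) := by rw [← neg_eq_iff_eq_neg.mpr hij]; noncomm_ring
      _ = _ := by rw [hi, hj]; simp [smul_smul, mul_comm]
  have h1 := conj i a hti hi
  have h2' := conj j c htj hj
  have h3 := conj (i * j) _ htk hkk
  -- Evaluating both sides with `conj`, the left one by applying it for `i` and then for `j`, leaves
  -- `x` with opposite coefficients `a * c` and `-(a * c)`, so that `x` can be solved for.
  have h4 : j * (i * x * i) * j = -((i * j) * x * (i * j)) := by
    rw [hij]; nth_rewrite 2 [← neg_eq_iff_eq_neg.mpr hij]; noncomm_ring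
  have h5 : j * i * j = -(c • i) := by
    rw [← neg_eq_iff_eq_neg.mpr hij, neg_mul, mul_assoc, hj]; simp
  rw [h1, h3] at h4
  simp only [mul_add, add_mul, mul_sub, sub_mul, mul_smul_comm, smul_mul_assoc, mul_one, h5, h2',
    hj, smul_sub, smul_add, smul_smul, smul_neg] at h4
  have h6 : (2 * a * c) • x = (a * c) • x + (a * c) • x := by rw [← add_smul]; congr 1; ring
  rw [h6]
  linear_combination (norm := module) h4

/-- The quaternion basis attached to two anticommuting square roots of scalars. -/
@[simps]
def quaternionBasis {i j : E} {a c : S} (hi : i * i = a • 1) (hj : j * j = c • 1)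
    (hij : i * j = -(j * i)) : QuaternionAlgebra.Basis E a 0 c where
  i := i
  j := j
  k := i * j
  i_mul_i := by simp [hi]
  j_mul_j := hj
  i_mul_j := rfl
  j_mul_i := by simp [hij]

theorem trace_liftHom (ht : IsCayleyHamilton t) (h2 : IsUnit (2 : S)) {i j : E} {a c : S}
    (ha : IsUnit a) (hc : IsUnit c) (hi : i * i = a • 1) (hj : j * j = c • 1)
    (hij : i * j = -(j * i)) (q : QuaternionAlgebra S a 0 c) :
    t ((quaternionBasis hi hj hij).liftHom q) = 2 * q.re := by
  have hti : t i = 0 := ht.trace_eq_zero_of_anticomm h2 hc hj hij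
  have htj : t j = 0 := ht.trace_eq_zero_of_anticomm h2 ha hi (by rw [hij, neg_neg])
  have htk : t (i * j) = 0 := by
    have h : t (i * j) = - t (i * j) := by
      conv_lhs => rw [hij, map_neg, ht.map_mul_comm]
    apply h2.mul_left_cancel
    linear_combination h
  change t ((quaternionBasis hi hj hij).lift q) = _
  simp [QuaternionAlgebra.Basis.lift, Algebra.algebraMap_eq_smul_one, hti, htj, htk, ht.map_one,
    mul_comm]

/-- Injectivity is nondegeneracy of the trace form of the quaternion algebra, tested on `1, i, j,
k`. Surjectivity is the expansion, `2 * a * c` being a unit. -/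
theorem liftHom_bijective (ht : IsCayleyHamilton t) (h2 : IsUnit (2 : S)) {i j : E} {a c : S}
    (ha : IsUnit a) (hc : IsUnit c) (hi : i * i = a • 1) (hj : j * j = c • 1)
    (hij : i * j = -(j * i)) : Function.Bijective (quaternionBasis hi hj hij).liftHom := by
  constructor
  · rw [injective_iff_map_eq_zero]
    intro q hq
    have key : ∀ r : QuaternionAlgebra S a 0 c, (q * r).re = 0 := by
      intro r
      apply h2.mul_left_cancel
      rw [← ht.trace_liftHom h2 ha hc hi hj hij, map_mul, hq]
      simp
    have h1 := key 1
    have hi' := key ⟨0, 1, 0, 0⟩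
    have hj' := key ⟨0, 0, 1, 0⟩
    have hk' := key ⟨0, 0, 0, 1⟩
    simp at h1 hi' hj' hk'
    rw [ha.mul_right_eq_zero] at hi'
    rw [hc.mul_right_eq_zero] at hj'
    rw [(ha.mul hc).mul_right_eq_zero] at hk'
    ext <;> assumption
  · intro x
    obtain ⟨d, hd⟩ := ((h2.mul ha).mul hc).exists_right_inv
    refine ⟨d • ⟨a * c * t x, c * t (x * i), a * t (x * j), - t (x * (i * j))⟩, ?_⟩
    have hx : x = d • ((2 * a * c) • x) := by rw [smul_smul, mul_comm d, hd, one_smul]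
    conv_rhs => rw [hx, ht.expansion h2 ha hc hi hj hij x]
    rw [map_smul]
    congr 1
    change (quaternionBasis hi hj hij).lift _ = _
    simp [QuaternionAlgebra.Basis.lift, Algebra.algebraMap_eq_smul_one, sub_eq_add_neg]

end IsCayleyHamilton

/-- Square matrices of size two form a Cayley–Hamilton algebra. -/
theorem isCayleyHamilton_matrix (S : Type*) [CommRing S] :
    IsCayleyHamilton (Matrix.traceLinearMap (Fin 2) S S) where
  map_one := by simp
  map_mul_comm x y := Matrix.trace_mul_comm x y
  polar x y := by
    ext m n
    fin_cases m <;> fin_cases n <;>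
      simp [Matrix.mul_apply, Fin.sum_univ_two, Matrix.trace_fin_two] <;> ring

/-- A trace-preserving homomorphism from a Cayley–Hamilton algebra to another one, sending a given
quaternion basis to a given quaternion basis. -/
theorem IsCayleyHamilton.exists_algHom {S E F : Type*} [CommRing S] [Ring E] [Algebra S E]
    [Ring F] [Algebra S F] {t : E →ₗ[S] S} {t' : F →ₗ[S] S} (ht : IsCayleyHamilton t)
    (ht' : IsCayleyHamilton t') (h2 : IsUnit (2 : S)) {i j : E} {i' j' : F} {a c : S}
    (ha : IsUnit a) (hc : IsUnit c) (hi : i * i = a • 1) (hj : j * j = c • 1)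
    (hij : i * j = -(j * i)) (hi' : i' * i' = a • 1) (hj' : j' * j' = c • 1)
    (hij' : i' * j' = -(j' * i')) :
    ∃ Φ : E →ₐ[S] F, Φ i = i' ∧ Φ j = j' ∧ ∀ x, t' (Φ x) = t x := by
  let e := AlgEquiv.ofBijective _ (ht.liftHom_bijective h2 ha hc hi hj hij)
  let f := (quaternionBasis hi' hj' hij').liftHom
  have hei : e ⟨0, 1, 0, 0⟩ = i := by
    change (quaternionBasis hi hj hij).lift _ = _
    simp [QuaternionAlgebra.Basis.lift]
  have hej : e ⟨0, 0, 1, 0⟩ = j := by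
    change (quaternionBasis hi hj hij).lift _ = _
    simp [QuaternionAlgebra.Basis.lift]
  refine ⟨f.comp e.symm.toAlgHom, ?_, ?_, fun x => ?_⟩
  · change f (e.symm i) = i'
    rw [← hei, e.symm_apply_apply]
    change (quaternionBasis hi' hj' hij').lift _ = _
    simp [QuaternionAlgebra.Basis.lift]
  · change f (e.symm j) = j'
    rw [← hej, e.symm_apply_apply]
    change (quaternionBasis hi' hj' hij').lift _ = _
    simp [QuaternionAlgebra.Basis.lift]
  · change t' (f (e.symm x)) = t x
    obtain ⟨q, rfl⟩ := e.surjective x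
    rw [e.symm_apply_apply, ht'.trace_liftHom h2 ha hc hi' hj' hij',
      ← ht.trace_liftHom h2 ha hc hi hj hij]
    rfl

/-! ### Generic pairs in irreducible matrix representations -/

section GenericPair

open Matrix

/-- A two-dimensional matrix representation without invariant lines. -/
def HasNoInvariantLine {P : Type*} [Monoid P] {K : Type*} [Field K]
    (M : P →* Matrix (Fin 2) (Fin 2) K) : Prop :=
  ∀ v : Fin 2 → K, v ≠ 0 → ∃ g, ∀ c : K, M g *ᵥ v ≠ c • v

variable {P : Type*} [Monoid P] {K : Type*} [Field K]

/-- Conjugation of a matrix representation. -/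
def conjMatrixRep (M : P →* Matrix (Fin 2) (Fin 2) K) (Q Q' : Matrix (Fin 2) (Fin 2) K)
    (hQ : Q * Q' = 1) : P →* Matrix (Fin 2) (Fin 2) K where
  toFun g := Q' * M g * Q
  map_one' := by rw [map_one, mul_one, mul_eq_one_comm.mp hQ]
  map_mul' g h := by
    rw [map_mul]
    calc Q' * (M g * M h) * Q = Q' * M g * 1 * M h * Q := by simp only [mul_one, mul_assoc]
      _ = _ := by rw [← hQ]; simp only [mul_assoc]

theorem HasNoInvariantLine.conj {M : P →* Matrix (Fin 2) (Fin 2) K} (hM : HasNoInvariantLine M)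
    {Q Q' : Matrix (Fin 2) (Fin 2) K} (hQ : Q * Q' = 1) :
    HasNoInvariantLine (conjMatrixRep M Q Q' hQ) := by
  intro v hv
  obtain ⟨g, hg⟩ := hM (Q *ᵥ v) (fun h => hv (by
    have := congrArg (Q' *ᵥ ·) h
    simpa only [Matrix.mulVec_mulVec, mul_eq_one_comm.mp hQ, Matrix.one_mulVec,
      Matrix.mulVec_zero] using this))
  refine ⟨g, fun c h => hg c ?_⟩
  have h' : Q *ᵥ ((Q' * M g * Q) *ᵥ v) = Q *ᵥ (c • v) := congrArg (Q *ᵥ ·) h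
  rwa [Matrix.mulVec_mulVec, ← mul_assoc, ← mul_assoc, hQ, one_mul, ← Matrix.mulVec_mulVec,
    Matrix.mulVec_smul] at h'

theorem conjMatrixRep_trace (M : P →* Matrix (Fin 2) (Fin 2) K) {Q Q' : Matrix (Fin 2) (Fin 2) K}
    (hQ : Q * Q' = 1) (g : P) : (conjMatrixRep M Q Q' hQ g).trace = (M g).trace := by
  change (Q' * M g * Q).trace = _
  rw [Matrix.trace_mul_comm, ← mul_assoc, hQ, one_mul]

theorem conjMatrixRep_det (M : P →* Matrix (Fin 2) (Fin 2) K) {Q Q' : Matrix (Fin 2) (Fin 2) K}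
    (hQ : Q * Q' = 1) (g : P) : (conjMatrixRep M Q Q' hQ g).det = (M g).det := by
  change (Q' * M g * Q).det = _
  rw [Matrix.det_mul_comm, ← mul_assoc, hQ, one_mul]

theorem conjMatrixRep_det_commutator (M : P →* Matrix (Fin 2) (Fin 2) K)
    {Q Q' : Matrix (Fin 2) (Fin 2) K} (hQ : Q * Q' = 1) (g h : P) :
    (conjMatrixRep M Q Q' hQ g * conjMatrixRep M Q Q' hQ h
      - conjMatrixRep M Q Q' hQ h * conjMatrixRep M Q Q' hQ g).det
      = (M g * M h - M h * M g).det := by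
  rw [← map_mul, ← map_mul]
  change (Q' * M (g * h) * Q - Q' * M (h * g) * Q).det = _
  rw [← sub_mul, ← mul_sub, Matrix.det_mul_comm, ← mul_assoc, hQ, one_mul, map_mul, map_mul]

theorem HasNoInvariantLine.exists_apply_one_zero_ne {M : P →* Matrix (Fin 2) (Fin 2) K}
    (hM : HasNoInvariantLine M) : ∃ g, M g 1 0 ≠ 0 := by
  obtain ⟨g, hg⟩ := hM ![1, 0] (by simp)
  refine ⟨g, fun h => hg (M g 0 0) ?_⟩
  ext i; fin_cases i <;> simp [Matrix.mulVec, dotProduct, Fin.sum_univ_two, h]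

theorem HasNoInvariantLine.exists_apply_zero_one_ne {M : P →* Matrix (Fin 2) (Fin 2) K}
    (hM : HasNoInvariantLine M) : ∃ g, M g 0 1 ≠ 0 := by
  obtain ⟨g, hg⟩ := hM ![0, 1] (by simp)
  refine ⟨g, fun h => hg (M g 1 1) ?_⟩
  ext i; fin_cases i <;> simp [Matrix.mulVec, dotProduct, Fin.sum_univ_two, h]

theorem exists_eigenvector_of_charpoly_root {X : Matrix (Fin 2) (Fin 2) K} {l : K}
    (hl : l ^ 2 - X.trace * l + X.det = 0) : ∃ v ≠ 0, X *ᵥ v = l • v := by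
  obtain ⟨v, hv, h⟩ := (Matrix.exists_mulVec_eq_zero_iff (M := X - l • 1)).mpr (by
    rw [Matrix.det_fin_two] at hl ⊢
    rw [Matrix.trace_fin_two] at hl
    simp
    linear_combination hl)
  refine ⟨v, hv, ?_⟩
  rwa [Matrix.sub_mulVec, Matrix.smul_mulVec, Matrix.one_mulVec, sub_eq_zero] at h

theorem exists_smul_eq_of_det_eq_zero {v w : Fin 2 → K} (hv : v ≠ 0)
    (h : v 0 * w 1 - w 0 * v 1 = 0) : ∃ c : K, w = c • v := by
  by_cases h0 : v 0 = 0
  · have h1 : v 1 ≠ 0 := fun h1 => hv (by ext i; fin_cases i <;> assumption)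
    refine ⟨w 1 / v 1, ?_⟩
    ext i; fin_cases i
    · simp [h0] at h ⊢; tauto
    · simp [h1]
  · refine ⟨w 0 / v 0, ?_⟩
    ext i; fin_cases i
    · simp [h0]
    · simp; field_simp; linear_combination h

/-- The matrix with two given columns has an inverse if its determinant does not vanish. -/
theorem exists_rightInverse_of_columns {v w : Fin 2 → K} (h : v 0 * w 1 - w 0 * v 1 ≠ 0) :
    ∃ Q', !![v 0, w 0; v 1, w 1] * Q' = 1 :=
  ⟨_, Matrix.mul_nonsing_inv _ (by rw [Matrix.det_fin_two_of]; exact h.isUnit)⟩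

theorem columns_mulVec_zero (v w : Fin 2 → K) : !![v 0, w 0; v 1, w 1] *ᵥ ![1, 0] = v := by
  ext i; fin_cases i <;> simp [Matrix.mulVec, dotProduct, Fin.sum_univ_two]

theorem columns_mulVec_one (v w : Fin 2 → K) : !![v 0, w 0; v 1, w 1] *ᵥ ![0, 1] = w := by
  ext i; fin_cases i <;> simp [Matrix.mulVec, dotProduct, Fin.sum_univ_two]

/-- Suppose all traces are `±2`. A non-scalar `g` has an eigenvector `v`, and some `y` moves its
line. In the basis `v, y v`, the matrix of `g` has diagonal `l, l` and upper right entry `b ≠ 0`,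
while that of `y` has first column `(0, 1)` and last entry `s`. The traces of `y`, `g y` and `g² y`
are `s`, `b + l s` and `2 l b + l² s`, and they cannot all square to `4`. -/
theorem HasNoInvariantLine.exists_trace_sq_ne_four (h2 : (2 : K) ≠ 0)
    {M : P →* Matrix (Fin 2) (Fin 2) K} (hM : HasNoInvariantLine M) (hdet : ∀ g, (M g).det = 1) :
    ∃ g, (M g).trace ^ 2 ≠ 4 := by
  by_contra! H
  obtain ⟨g, hg⟩ := hM.exists_apply_one_zero_ne
  let l := (M g).trace / 2
  have hl : l ^ 2 = 1 := by
    have := H g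
    simp only [l]; field_simp; linear_combination this
  have htr : (M g).trace = 2 * l := by simp only [l]; field_simp
  obtain ⟨v, hv, hgv⟩ := exists_eigenvector_of_charpoly_root (X := M g) (l := l) (by
    rw [hdet, htr]; linear_combination -hl)
  obtain ⟨y, hy⟩ := hM v hv
  have hQ0 : v 0 * (M y *ᵥ v) 1 - (M y *ᵥ v) 0 * v 1 ≠ 0 := fun h => by
    obtain ⟨c, hc⟩ := exists_smul_eq_of_det_eq_zero hv h
    exact hy c hc
  obtain ⟨Q', hQ⟩ := exists_rightInverse_of_columns hQ0
  set Q := !![v 0, (M y *ᵥ v) 0; v 1, (M y *ᵥ v) 1] with hQdef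
  have hQ'Q := mul_eq_one_comm.mp hQ
  let N := conjMatrixRep M Q Q' hQ
  have hNtr : ∀ g, (N g).trace ^ 2 = 4 := fun g => by rw [conjMatrixRep_trace, H]
  have hgcol : N g *ᵥ ![1, 0] = l • ![1, 0] := by
    change (Q' * M g * Q) *ᵥ ![1, 0] = _
    rw [← Matrix.mulVec_mulVec, columns_mulVec_zero, ← Matrix.mulVec_mulVec, hgv,
      ← columns_mulVec_zero v (M y *ᵥ v), ← hQdef, ← Matrix.mulVec_smul, Matrix.mulVec_mulVec, hQ'Q,
      Matrix.one_mulVec]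
  have hycol : N y *ᵥ ![1, 0] = ![0, 1] := by
    change (Q' * M y * Q) *ᵥ ![1, 0] = _
    rw [← Matrix.mulVec_mulVec, columns_mulVec_zero, ← Matrix.mulVec_mulVec,
      ← columns_mulVec_one v (M y *ᵥ v), ← hQdef, Matrix.mulVec_mulVec, hQ'Q,
      Matrix.one_mulVec]
  have g00 : N g 0 0 = l := by
    simpa [Matrix.mulVec, dotProduct, Fin.sum_univ_two] using congrFun hgcol 0
  have g10 : N g 1 0 = 0 := by
    simpa [Matrix.mulVec, dotProduct, Fin.sum_univ_two] using congrFun hgcol 1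
  have y00 : N y 0 0 = 0 := by
    simpa [Matrix.mulVec, dotProduct, Fin.sum_univ_two] using congrFun hycol 0
  have y10 : N y 1 0 = 1 := by
    simpa [Matrix.mulVec, dotProduct, Fin.sum_univ_two] using congrFun hycol 1
  have hNg : (N g).trace = 2 * l := by rw [conjMatrixRep_trace, htr]
  have g11 : N g 1 1 = l := by
    rw [Matrix.trace_fin_two, g00] at hNg; linear_combination hNg
  have t1 := hNtr y
  have t2 := hNtr (g * y)
  have t3 := hNtr (g * (g * y))
  simp only [map_mul, Matrix.trace_fin_two, Matrix.mul_apply, Fin.sum_univ_two, g00, g10, y00, y10,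
    g11] at t1 t2 t3
  ring_nf at t1 t2 t3
  have hb : N g 0 1 ≠ 0 := by
    intro hb
    have hN : N g = l • 1 := by
      ext i j; fin_cases i <;> fin_cases j <;> simp [g00, g10, g11, hb]
    have : M g = l • 1 := by
      calc M g = Q * N g * Q' := by
            change _ = Q * (Q' * M g * Q) * Q'
            calc M g = (Q * Q') * M g * (Q * Q') := by rw [hQ]; simp
              _ = _ := by simp only [mul_assoc]
        _ = _ := by rw [hN]; simp [hQ]
    rw [this] at hg
    simp at hg
  generalize N g 0 1 = b at *
  generalize N y 1 1 = s at *
  have e1 : b + 2 * (s * l) = 0 := (mul_eq_zero.mp (show b * (b + 2 * (s * l)) = 0 by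
    linear_combination t2 - s ^ 2 * hl - t1)).resolve_left hb
  have h4 : (4 : K) ≠ 0 := by
    rw [show (4 : K) = 2 * 2 by norm_num]; exact mul_ne_zero h2 h2
  have e2 : s * l + b = 0 := (mul_eq_zero.mp (show (4 * b) * (s * l + b) = 0 by
    linear_combination t3 - (4 * s * l * b + s ^ 2 * (l ^ 2 + 1) + 4 * b ^ 2) * hl
      - t1)).resolve_left (mul_ne_zero h4 hb)
  have e3 : s * l = 0 := by linear_combination e1 - e2
  exact h4 (by linear_combination (s * l) * e3 - s ^ 2 * hl - t1)

/-- Once `g` is diagonal with eigenvalues `l ≠ m`, its commutator with `y` has determinant `(l -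
m)²` times the product of the off-diagonal entries of `y`. It suffices to make both of these
nonzero. -/
theorem HasNoInvariantLine.exists_generic_pair [IsAlgClosed K] (h2 : (2 : K) ≠ 0)
    {M : P →* Matrix (Fin 2) (Fin 2) K} (hM : HasNoInvariantLine M) (hdet : ∀ g, (M g).det = 1) :
    ∃ g h, (M g).trace ^ 2 ≠ 4 ∧ (M g * M h - M h * M g).det ≠ 0 := by
  obtain ⟨g, hg⟩ := hM.exists_trace_sq_ne_four h2 hdet
  suffices ∃ h, (M g * M h - M h * M g).det ≠ 0 from ⟨g, this.choose, hg, this.choose_spec⟩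
  obtain ⟨d, hd⟩ := IsAlgClosed.exists_pow_nat_eq ((M g).trace ^ 2 - 4) (n := 2) (by norm_num)
  have hd0 : d ≠ 0 := by
    rintro rfl
    apply hg; linear_combination -hd
  have h4 : (4 : K) ≠ 0 := by
    rw [show (4 : K) = 2 * 2 by norm_num]; exact mul_ne_zero h2 h2
  obtain ⟨v, hv, hgv⟩ := exists_eigenvector_of_charpoly_root (X := M g)
    (l := ((M g).trace + d) / 2) (by rw [hdet]; field_simp; linear_combination hd)
  obtain ⟨w, hw, hgw⟩ := exists_eigenvector_of_charpoly_root (X := M g)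
    (l := ((M g).trace - d) / 2) (by rw [hdet]; field_simp; linear_combination hd)
  set l := ((M g).trace + d) / 2
  set m := ((M g).trace - d) / 2
  have hlm : l - m ≠ 0 := by
    have : l - m = d := by simp only [l, m]; field_simp; ring
    rwa [this]
  have hQ0 : v 0 * w 1 - w 0 * v 1 ≠ 0 := fun h => by
    obtain ⟨c, rfl⟩ := exists_smul_eq_of_det_eq_zero hv h
    rw [Matrix.mulVec_smul, hgv, smul_comm, ← sub_eq_zero, ← sub_smul, smul_eq_zero] at hgw
    exact hgw.elim hlm hw
  obtain ⟨Q', hQ⟩ := exists_rightInverse_of_columns hQ0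
  set Q := !![v 0, w 0; v 1, w 1] with hQdef
  have hQ'Q := mul_eq_one_comm.mp hQ
  let N := conjMatrixRep M Q Q' hQ
  have hN : HasNoInvariantLine N := hM.conj hQ
  have hNdet : ∀ g, (N g).det = 1 := fun g => by rw [conjMatrixRep_det, hdet]
  have hcol0 : N g *ᵥ ![1, 0] = l • ![1, 0] := by
    change (Q' * M g * Q) *ᵥ ![1, 0] = _
    rw [← Matrix.mulVec_mulVec, columns_mulVec_zero, ← Matrix.mulVec_mulVec, hgv,
      ← columns_mulVec_zero v w, ← hQdef, ← Matrix.mulVec_smul, Matrix.mulVec_mulVec, hQ'Q,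
      Matrix.one_mulVec]
  have hcol1 : N g *ᵥ ![0, 1] = m • ![0, 1] := by
    change (Q' * M g * Q) *ᵥ ![0, 1] = _
    rw [← Matrix.mulVec_mulVec, columns_mulVec_one, ← Matrix.mulVec_mulVec, hgw,
      ← columns_mulVec_one v w, ← hQdef, ← Matrix.mulVec_smul, Matrix.mulVec_mulVec, hQ'Q,
      Matrix.one_mulVec]
  have g00 : N g 0 0 = l := by
    simpa [Matrix.mulVec, dotProduct, Fin.sum_univ_two] using congrFun hcol0 0
  have g10 : N g 1 0 = 0 := by
    simpa [Matrix.mulVec, dotProduct, Fin.sum_univ_two] using congrFun hcol0 1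
  have g01 : N g 0 1 = 0 := by
    simpa [Matrix.mulVec, dotProduct, Fin.sum_univ_two] using congrFun hcol1 0
  have g11 : N g 1 1 = m := by
    simpa [Matrix.mulVec, dotProduct, Fin.sum_univ_two] using congrFun hcol1 1
  suffices ∃ y, N y 0 1 ≠ 0 ∧ N y 1 0 ≠ 0 by
    obtain ⟨y, h01, h10⟩ := this
    refine ⟨y, ?_⟩
    rw [← conjMatrixRep_det_commutator M hQ]
    change (N g * N y - N y * N g).det ≠ 0
    have : (N g * N y - N y * N g).det = (l - m) ^ 2 * (N y 0 1 * N y 1 0) := by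
      simp [Matrix.det_fin_two, Matrix.mul_apply, Fin.sum_univ_two, g00, g10, g01, g11]
      ring
    rw [this]
    exact mul_ne_zero (pow_ne_zero _ hlm) (mul_ne_zero h01 h10)
  obtain ⟨x, hx⟩ := hN.exists_apply_one_zero_ne
  obtain ⟨y, hy⟩ := hN.exists_apply_zero_one_ne
  by_cases hx' : N x 0 1 = 0
  swap; · exact ⟨x, hx', hx⟩
  by_cases hy' : N y 1 0 = 0
  swap; · exact ⟨y, hy, hy'⟩
  have hdx := hNdet x
  have hdy := hNdet y
  rw [Matrix.det_fin_two, hx', zero_mul, sub_zero] at hdx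
  rw [Matrix.det_fin_two, hy', mul_zero, sub_zero] at hdy
  -- Here `x` is lower and `y` upper triangular, both invertible with a nonzero off-diagonal entry,
  -- so `x * y` has both off-diagonal entries nonzero.
  refine ⟨x * y, ?_, ?_⟩
  · simp [Matrix.mul_apply, Fin.sum_univ_two, hx', hy, left_ne_zero_of_mul_eq_one hdx]
  · simp [Matrix.mul_apply, Fin.sum_univ_two, hy', hx, left_ne_zero_of_mul_eq_one hdy]

end GenericPair

/-! ### Generic pairs for absolutely irreducible representations -/

section AbsolutelyIrreducible

open Matrix

variable {P : Type p} [Group P] {k : Type v} [Field k]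

theorem hasNoInvariantLine_of_isIrreducible
    (ρ : P →* Matrix.SpecialLinearGroup (Fin 2) k) (h : (sl2StdRep ρ).IsIrreducible) :
    HasNoInvariantLine (Matrix.SpecialLinearGroup.coeMonoidHom.comp ρ) := by
  intro v hv
  by_contra! H
  let V : Subrepresentation (sl2StdRep ρ) :=
    { toSubmodule := k ∙ v
      apply_mem_toSubmodule := by
        intro g w hw
        obtain ⟨a, rfl⟩ := Submodule.mem_span_singleton.mp hw
        obtain ⟨c, hc⟩ := H g
        rw [map_smul]
        refine Submodule.smul_mem _ _ (Submodule.mem_span_singleton.mpr ⟨c, ?_⟩)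
        rw [← hc]
        rfl }
  rcases h.eq_bot_or_eq_top V with hV | hV
  · have : k ∙ v = ⊥ := congrArg Subrepresentation.toSubmodule hV
    exact hv (Submodule.span_singleton_eq_bot.mp this)
  · have : k ∙ v = ⊤ := congrArg Subrepresentation.toSubmodule hV
    have h1 := finrank_span_singleton (K := k) hv
    rw [this, finrank_top] at h1
    simp at h1

/-- An absolutely irreducible representation into `SL₂(k)` has a regular semisimple element and
another element, which have no common eigenvector over the algebraic closure. -/
theorem IsAbsolutelyIrreducibleSL2.exists_generic_pair (h2 : (2 : k) ≠ 0)
    {ρ : P →* Matrix.SpecialLinearGroup (Fin 2) k} (hρ : IsAbsolutelyIrreducibleSL2 ρ) :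
    ∃ g h, (ρ g : Matrix (Fin 2) (Fin 2) k).trace ^ 2 ≠ 4 ∧
      ((ρ g : Matrix (Fin 2) (Fin 2) k) * (ρ h : Matrix (Fin 2) (Fin 2) k) -
        (ρ h : Matrix (Fin 2) (Fin 2) k) * (ρ g : Matrix (Fin 2) (Fin 2) k)).det ≠ 0 := by
  let φ := algebraMap k (AlgebraicClosure k)
  obtain ⟨g, h, h₁, h₂⟩ := (hasNoInvariantLine_of_isIrreducible _ hρ).exists_generic_pair
    (by simpa only [map_ofNat] using (map_ne_zero φ).mpr h2)
    (fun g => Matrix.SpecialLinearGroup.det_coe _)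
  refine ⟨g, h, fun H => h₁ ?_, fun H => h₂ ?_⟩
  · have : ((ρ g : Matrix (Fin 2) (Fin 2) k).map φ).trace ^ 2 = 4 := by
      rw [← AddMonoidHom.map_trace, ← map_pow]
      rw [H, map_ofNat]
    exact this
  · have : ((ρ g : Matrix (Fin 2) (Fin 2) k).map φ * (ρ h : Matrix (Fin 2) (Fin 2) k).map φ
        - (ρ h : Matrix (Fin 2) (Fin 2) k).map φ * (ρ g : Matrix (Fin 2) (Fin 2) k).map φ).det
        = 0 := by
      rw [← Matrix.map_mul, ← Matrix.map_mul, ← Matrix.map_sub _ (map_sub φ)]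
      have := RingHom.map_det φ
        ((ρ g : Matrix (Fin 2) (Fin 2) k) * (ρ h : Matrix (Fin 2) (Fin 2) k) -
        (ρ h : Matrix (Fin 2) (Fin 2) k) * (ρ g : Matrix (Fin 2) (Fin 2) k))
      rw [H, map_zero] at this
      exact this.symm
    exact this

end AbsolutelyIrreducible

/-! ### The anticommuting pair attached to two group elements -/

section TracelessPair

variable {P : Type p} [Group P] {S : Type w} [CommRing S]

/-- The square of the traceless part of `g`, as a function of the traces; here `2 * r = 1`. -/
def tracelessSq (r : S) (T : P → S) (g : P) : S := r ^ 2 * T g ^ 2 - 1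

/-- The square of the commutator of `g` and `h`, as a function of the traces. -/
def commutatorSq (T : P → S) (g h : P) : S := T (g * h * g * h) - T (g * g * h * h)

variable {E : Type*} [Ring E] [Algebra S E] {t : E →ₗ[S] S} {T : P → S}

/-- The traceless part of the image of `g`. -/
def tracelessPart (r : S) (T : P → S) (ι : P →* E) (g : P) : E := ι g - (r * T g) • 1

/-- The commutator of the images of `g` and `h`. -/
def ringCommutator (ι : P →* E) (g h : P) : E := ι g * ι h - ι h * ι g

variable (ht : IsCayleyHamilton t) (hT : IsPseudoSL2Rep T) {r : S} (hr : 2 * r = 1)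
  {ι : P →* E} (hι : ∀ g, t (ι g) = T g)
include ht hT hr hι

theorem tracelessPart_mul_self (g : P) :
    tracelessPart r T ι g * tracelessPart r T ι g = tracelessSq r T g • 1 := by
  refine ht.sq_of_trace_eq_zero (.of_mul_eq_one _ hr) ?_ ?_
  · simp only [tracelessPart, map_sub, map_smul, hι, ht.map_one, smul_eq_mul]
    linear_combination -T g * hr
  · have h := hT.sq_sub g
    rw [pow_two g, ← hι (g * g), map_mul] at h
    simp only [tracelessPart, tracelessSq, mul_sub, sub_mul, map_sub, map_smul, hι, ht.map_one,
      smul_eq_mul, mul_smul_comm, smul_mul_assoc, mul_one, one_mul]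
    linear_combination h + T g ^ 2 * hr

theorem ringCommutator_mul_self (g h : P) :
    ringCommutator ι g h * ringCommutator ι g h = commutatorSq T g h • 1 := by
  refine ht.sq_of_trace_eq_zero (.of_mul_eq_one _ hr) ?_ ?_
  · simp [ringCommutator, ht.map_mul_comm (ι g)]
  · simp only [ringCommutator, commutatorSq, mul_sub, sub_mul, map_sub, ← map_mul, hι, ← mul_assoc]
    have e₁ : T (h * g * g * h) = T (g * g * h * h) := by
      simpa only [mul_assoc] using hT.map_mul_comm h (g * g * h)
    have e₂ : T (g * h * h * g) = T (g * g * h * h) := by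
      simpa only [mul_assoc] using hT.map_mul_comm (g * h * h) g
    have e₃ : T (h * g * h * g) = T (g * h * g * h) := by
      simpa only [mul_assoc] using hT.map_mul_comm h (g * h * g)
    linear_combination e₁ + e₂ - e₃

/-- Subtracting a scalar does not change a commutator, and an element with scalar square
anticommutes with all its commutators. -/
theorem tracelessPart_mul_ringCommutator (g h : P) :
    tracelessPart r T ι g * ringCommutator ι g h =
      -(ringCommutator ι g h * tracelessPart r T ι g) := by
  have h1 := tracelessPart_mul_self ht hT hr hι g
  have h2 : ringCommutator ι g h = tracelessPart r T ι g * ι h - ι h * tracelessPart r T ι g := by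
    simp [ringCommutator, tracelessPart, sub_mul, mul_sub]
  rw [h2, mul_sub, sub_mul, mul_assoc (ι h), h1, ← mul_assoc, h1, ← mul_assoc]
  simp

end TracelessPair

/-! ### Lifts with equal traces are strictly equivalent -/

section Uniqueness

open Matrix

variable {P : Type p} [Group P] {S : Type w} [CommRing S]

/-- The `2 × 2` identity for traces of a homomorphism into `SL₂`. -/
theorem isPseudoSL2Rep_sl2Trace (ρ : P →* Matrix.SpecialLinearGroup (Fin 2) S) :
    IsPseudoSL2Rep (sl2Trace ρ) where
  map_one := by simp [sl2Trace]
  map_mul_comm g h := by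
    simp only [sl2Trace, map_mul, Matrix.SpecialLinearGroup.coe_mul]
    exact Matrix.trace_mul_comm _ _
  triple g₁ g₂ g₃ := by
    simp only [sl2Trace, map_mul, Matrix.SpecialLinearGroup.coe_mul, Matrix.trace_fin_two,
      Matrix.mul_apply, Fin.sum_univ_two]
    ring
  sq_sub g := by
    have h := Matrix.SpecialLinearGroup.det_coe (ρ g)
    rw [Matrix.det_fin_two] at h
    simp only [sl2Trace, pow_two g, map_mul, Matrix.SpecialLinearGroup.coe_mul,
      Matrix.trace_fin_two, Matrix.mul_apply, Fin.sum_univ_two]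
    linear_combination 2 * h

/-- The matrix algebra homomorphism underlying a homomorphism into `SL₂`. -/
def sl2Coe (ρ : P →* Matrix.SpecialLinearGroup (Fin 2) S) : P →* Matrix (Fin 2) (Fin 2) S :=
  Matrix.SpecialLinearGroup.coeMonoidHom.comp ρ

theorem traceLinearMap_sl2Coe (ρ : P →* Matrix.SpecialLinearGroup (Fin 2) S) (g : P) :
    Matrix.traceLinearMap (Fin 2) S S (sl2Coe ρ g) = sl2Trace ρ g := rfl

/-- Expansion of `ρ b` with coefficients depending on the trace only. -/
theorem sl2Coe_expansion {T : P → S} {r : S} (hr : 2 * r = 1)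
    {ρ : P →* Matrix.SpecialLinearGroup (Fin 2) S} (hρ : sl2Trace ρ = T) {g h : P}
    (ha : IsUnit (tracelessSq r T g)) (hc : IsUnit (commutatorSq T g h)) (b : P) :
    (2 * tracelessSq r T g * commutatorSq T g h) • sl2Coe ρ b =
      (tracelessSq r T g * commutatorSq T g h * T b) • (1 : Matrix (Fin 2) (Fin 2) S)
      + (commutatorSq T g h * (T (b * g) - r * T g * T b)) • tracelessPart r T (sl2Coe ρ) g
      + (tracelessSq r T g * (T (b * (g * h)) - T (b * (h * g)))) • ringCommutator (sl2Coe ρ) g h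
      - (T (b * (g * (g * h))) - T (b * (g * (h * g)))
          - r * T g * (T (b * (g * h)) - T (b * (h * g)))) •
        (tracelessPart r T (sl2Coe ρ) g * ringCommutator (sl2Coe ρ) g h) := by
  have hT : IsPseudoSL2Rep T := hρ ▸ isPseudoSL2Rep_sl2Trace ρ
  have hι : ∀ g, Matrix.traceLinearMap (Fin 2) S S (sl2Coe ρ g) = T g := fun g => hρ ▸ rfl
  have ht := isCayleyHamilton_matrix S
  rw [ht.expansion (.of_mul_eq_one _ hr) ha hc (tracelessPart_mul_self ht hT hr hι g)
    (ringCommutator_mul_self ht hT hr hι g h)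
    (tracelessPart_mul_ringCommutator ht hT hr hι g h) (sl2Coe ρ b)]
  congr 4
  all_goals
    simp only [hι, tracelessPart, ringCommutator, mul_sub, sub_mul, map_sub, ← map_mul, map_smul,
      mul_smul_comm, smul_mul_assoc, mul_one, one_mul, smul_eq_mul]
  ring

theorem mem_maximalIdeal_iff_of_surjective [IsLocalRing S] {k : Type v} [Field k] {res : S →+* k}
    (hres : Function.Surjective res) (x : S) : x ∈ maximalIdeal S ↔ res x = 0 := by
  rw [← IsLocalRing.ker_eq_maximalIdeal res hres, RingHom.mem_ker]

theorem isUnit_iff_of_surjective [IsLocalRing S] {k : Type v} [Field k] {res : S →+* k}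
    (hres : Function.Surjective res) (x : S) : IsUnit x ↔ res x ≠ 0 := by
  rw [ne_eq, ← mem_maximalIdeal_iff_of_surjective hres, IsLocalRing.notMem_maximalIdeal]

/-- Two lifts of a representation with the same trace are strictly equivalent, if some pair of
elements generates the matrix algebra. -/
theorem sl2StrictEquiv_of_sl2Trace_eq [IsLocalRing S] {k : Type v} [Field k] {res : S →+* k}
    (hres : Function.Surjective res) {r : S} (hr : 2 * r = 1) {T : P → S}
    {ρ ρ' : P →* Matrix.SpecialLinearGroup (Fin 2) S} (hρ : sl2Trace ρ = T) (hρ' : sl2Trace ρ' = T)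
    (hmod : ∀ g, res.mapMatrix (sl2Coe ρ g) = res.mapMatrix (sl2Coe ρ' g))
    {g h : P} (ha : IsUnit (tracelessSq r T g)) (hc : IsUnit (commutatorSq T g h)) :
    SL2StrictEquiv ρ ρ' := by
  have hT : IsPseudoSL2Rep T := hρ ▸ isPseudoSL2Rep_sl2Trace ρ
  have hι : ∀ g, Matrix.traceLinearMap (Fin 2) S S (sl2Coe ρ g) = T g := fun g => hρ ▸ rfl
  have hι' : ∀ g, Matrix.traceLinearMap (Fin 2) S S (sl2Coe ρ' g) = T g := fun g => hρ' ▸ rfl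
  have ht := isCayleyHamilton_matrix S
  have hi := tracelessPart_mul_self ht hT hr hι g
  have hj := ringCommutator_mul_self ht hT hr hι g h
  have hij := tracelessPart_mul_ringCommutator ht hT hr hι g h
  have hi' := tracelessPart_mul_self ht hT hr hι' g
  have hj' := ringCommutator_mul_self ht hT hr hι' g h
  have hij' := tracelessPart_mul_ringCommutator ht hT hr hι' g h
  have hexp := sl2Coe_expansion hr hρ ha hc
  have hexp' := sl2Coe_expansion hr hρ' ha hc
  have hmi : res.mapMatrix (tracelessPart r T (sl2Coe ρ) g) =
      res.mapMatrix (tracelessPart r T (sl2Coe ρ') g) := by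
    simp only [tracelessPart, map_sub, hmod]
  have hmj : res.mapMatrix (ringCommutator (sl2Coe ρ) g h) =
      res.mapMatrix (ringCommutator (sl2Coe ρ') g h) := by
    simp only [ringCommutator, map_sub, map_mul, hmod]
  generalize tracelessPart r T (sl2Coe ρ) g = i at *
  generalize ringCommutator (sl2Coe ρ) g h = j at *
  generalize tracelessPart r T (sl2Coe ρ') g = i' at *
  generalize ringCommutator (sl2Coe ρ') g h = j' at *
  generalize tracelessSq r T g = a at *
  generalize commutatorSq T g h = c at *
  -- Up to the factor `a * c`, this is the sum of `e * e'⁻¹` over corresponding elements of the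
  -- bases `1, i, j, ij` and `1, i', j', i'j'`, an average that intertwines them as in Schur's
  -- lemma.
  let γ := (a * c) • (1 : Matrix (Fin 2) (Fin 2) S) + c • (i * i') + a • (j * j')
    + i * j * j' * i'
  have h1 : i * γ = γ * i' := by
    simp only [γ, mul_add, add_mul, mul_smul_comm, smul_mul_assoc, mul_one, one_mul]
    rw [show i * (i * i') = a • i' by rw [← mul_assoc, hi]; simp,
      show i * i' * i' = a • i by rw [mul_assoc, hi']; simp,
      show i * (i * j * j' * i') = a • (j * j' * i') by
        rw [show i * (i * j * j' * i') = (i * i) * (j * j' * i') by noncomm_ring, hi]; simp,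
      show i * j * j' * i' * i' = a • (i * (j * j')) by
        rw [mul_assoc _ i', hi']; simp [mul_assoc]]
    module
  have h2 : j * γ = γ * j' := by
    simp only [γ, mul_add, add_mul, mul_smul_comm, smul_mul_assoc, mul_one, one_mul]
    rw [show j * (j * j') = c • j' by rw [← mul_assoc, hj]; simp,
      show j * j' * j' = c • j by rw [mul_assoc, hj']; simp,
      show i * j * j' * i' * j' = - (c • (i * j * i')) by
        rw [mul_assoc _ i', hij', mul_neg, ← mul_assoc, mul_assoc _ j' j', hj']; simp,
      show j * (i * j * j' * i') = -(c • (i * j' * i')) by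
        rw [show j * (i * j * j' * i') = (j * i) * j * j' * i' by noncomm_ring,
          ← neg_eq_iff_eq_neg.mpr hij, neg_mul, mul_assoc i j j, hj]; simp,
      show j * (i * i') = -(i * j * i') by rw [hij]; noncomm_ring,
      show i * i' * j' = -(i * j' * i') by rw [mul_assoc, hij']; noncomm_ring]
    module
  have h3 : ∀ b, sl2Coe ρ b * γ = γ * sl2Coe ρ' b := by
    intro b
    apply ((IsUnit.of_mul_eq_one _ hr).mul ha |>.mul hc).smul_left_cancel.mp
    rw [← smul_mul_assoc, ← mul_smul_comm, hexp, hexp']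
    simp only [mul_add, add_mul, mul_sub, sub_mul, mul_smul_comm, smul_mul_assoc, mul_one, one_mul,
      h1, h2]
    rw [mul_assoc i, h2, ← mul_assoc i, h1, mul_assoc γ]
  have h4 : res.mapMatrix γ = res.mapMatrix ((4 * (a * c)) • 1) := by
    have e : ∀ (s : S) (M N : Matrix (Fin 2) (Fin 2) S), res.mapMatrix M = res.mapMatrix N →
        res.mapMatrix (s • M) = res.mapMatrix (s • N) := fun s M N h => by
      rw [← smul_one_mul s M, ← smul_one_mul s N, map_mul, map_mul, h]
    have h : (4 * (a * c)) • (1 : Matrix (Fin 2) (Fin 2) S) =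
        (a * c) • 1 + c • (i * i) + a • (j * j) + i * j * j * i := by
      rw [show i * j * j * i = i * (j * j) * i by noncomm_ring, hj, hi]
      simp only [mul_smul_comm, smul_mul_assoc, mul_one, hi]
      module
    rw [h]
    simp only [γ, map_add, e c (i * i') (i * i) (by rw [map_mul, map_mul, hmi]),
      e a (j * j') (j * j) (by rw [map_mul, map_mul, hmj])]
    simp only [map_mul, hmi, hmj]
  obtain ⟨δ, hδ⟩ := (ha.mul hc).exists_right_inv
  -- Modulo the maximal ideal the two bases agree, so `γ` reduces to `4 * a * c`, and `d` is the
  -- inverse of this scalar.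
  let d := r * r * δ
  have h5 : res.mapMatrix (d • γ) = 1 := by
    rw [← smul_one_mul d γ, map_mul, h4, ← map_mul, smul_one_mul, smul_smul,
      show d * (4 * (a * c)) = 1 by
        simp only [d]; linear_combination (2 * r) ^ 2 * hδ + (2 * r + 1) * hr, one_smul, map_one]
  have h6 : IsUnit (d • γ).det := by
    rw [isUnit_iff_of_surjective hres, RingHom.map_det, h5]
    simp
  have h7 := (Matrix.isUnit_iff_isUnit_det _).mpr h6
  refine ⟨h7.unit, fun m n => ?_, fun b => ?_⟩
  · rw [mem_maximalIdeal_iff_of_surjective hres, map_sub, sub_eq_zero]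
    exact congrFun (congrFun (h5.trans (map_one res.mapMatrix).symm) m) n
  · have h8 : sl2Coe ρ b * (h7.unit : Matrix (Fin 2) (Fin 2) S) = h7.unit * sl2Coe ρ' b := by
      rw [IsUnit.unit_spec, mul_smul_comm, h3, smul_mul_assoc]
    change sl2Coe ρ' b = _ * sl2Coe ρ b * _
    rw [mul_assoc, h8, Units.inv_mul_cancel_left]

end Uniqueness

/-! ### The group algebra modulo the radical of the trace form -/

section TraceQuotient

variable {P : Type p} [Group P] {S : Type w} [CommRing S]

/-- The linear extension of a function on a group to the group algebra. -/
noncomputable def linearExtension (T : P → S) : MonoidAlgebra S P →ₗ[S] S :=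
  Finsupp.linearCombination S T ∘ₗ (MonoidAlgebra.coeffLinearEquiv S).toLinearMap

theorem linearExtension_of (T : P → S) (g : P) :
    linearExtension T (MonoidAlgebra.of S P g) = T g := by
  simp [linearExtension]

variable {T : P → S} (hT : IsPseudoSL2Rep T)
include hT

theorem IsPseudoSL2Rep.linearExtension_mul_comm (x y : MonoidAlgebra S P) :
    linearExtension T (x * y) = linearExtension T (y * x) := by
  induction x using MonoidAlgebra.induction_on with
  | add x x' h h' => simp only [add_mul, mul_add, map_add, h, h']
  | smul r x h => simp only [smul_mul_assoc, mul_smul_comm, map_smul, h]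
  | of g =>
    induction y using MonoidAlgebra.induction_on with
    | add x x' h h' => simp only [add_mul, mul_add, map_add, h, h']
    | smul r x h => simp only [smul_mul_assoc, mul_smul_comm, map_smul, h]
    | of h => rw [← map_mul, ← map_mul, linearExtension_of, linearExtension_of, hT.map_mul_comm]

theorem IsPseudoSL2Rep.linearExtension_triple (x y z : MonoidAlgebra S P) :
    linearExtension T x * linearExtension T y * linearExtension T z
      + linearExtension T (x * y * z) + linearExtension T (x * z * y)
      - linearExtension T (x * y) * linearExtension T z
      - linearExtension T (y * z) * linearExtension T x
      - linearExtension T (x * z) * linearExtension T y = 0 := by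
  induction x using MonoidAlgebra.induction_on with
  | add x x' h h' =>
    simp only [add_mul, mul_add, map_add]
    linear_combination h + h'
  | smul r x h =>
    simp only [smul_mul_assoc, map_smul, smul_eq_mul]
    linear_combination r * h
  | of g₁ =>
    induction y using MonoidAlgebra.induction_on with
    | add x x' h h' =>
      simp only [add_mul, mul_add, map_add]
      linear_combination h + h'
    | smul r x h =>
      simp only [smul_mul_assoc, mul_smul_comm, map_smul, smul_eq_mul]
      linear_combination r * h
    | of g₂ =>
      induction z using MonoidAlgebra.induction_on with
      | add x x' h h' =>
        simp only [add_mul, mul_add, map_add]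
        linear_combination h + h'
      | smul r x h =>
        simp only [smul_mul_assoc, mul_smul_comm, map_smul, smul_eq_mul]
        linear_combination r * h
      | of g₃ =>
        simp only [← map_mul, linearExtension_of]
        exact hT.triple g₁ g₂ g₃

/-- The radical of the trace form. -/
def IsPseudoSL2Rep.radical : Ideal (MonoidAlgebra S P) where
  carrier := {x | ∀ y, linearExtension T (x * y) = 0}
  add_mem' hx hy z := by rw [add_mul, map_add, hx, hy, add_zero]
  zero_mem' z := by simp
  smul_mem' c x hx y := by
    rw [smul_eq_mul, mul_assoc, hT.linearExtension_mul_comm, mul_assoc, hx]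

theorem IsPseudoSL2Rep.mem_radical (x : MonoidAlgebra S P) :
    x ∈ hT.radical ↔ ∀ y, linearExtension T (x * y) = 0 := Iff.rfl

instance IsPseudoSL2Rep.isTwoSided_radical : hT.radical.IsTwoSided where
  mul_mem_of_left {x} z hx y := by rw [mul_assoc, hx]

/-- The trace on the quotient of the group algebra by the radical. -/
noncomputable def IsPseudoSL2Rep.quotientTrace : (MonoidAlgebra S P ⧸ hT.radical) →ₗ[S] S :=
  ((hT.radical.restrictScalars S).liftQ (linearExtension T) (fun x hx => by
    have := hx 1
    rwa [mul_one] at this)) ∘ₗ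
    (Submodule.Quotient.restrictScalarsEquiv S hT.radical).symm.toLinearMap

theorem IsPseudoSL2Rep.quotientTrace_mk (x : MonoidAlgebra S P) :
    hT.quotientTrace (Ideal.Quotient.mk _ x) = linearExtension T x := rfl

/-- The triple relation says that the polarized Cayley–Hamilton expression is orthogonal to every
`z`, so it vanishes modulo the radical. -/
theorem IsPseudoSL2Rep.isCayleyHamilton_quotientTrace : IsCayleyHamilton hT.quotientTrace where
  map_one := by
    rw [← _root_.map_one (Ideal.Quotient.mk hT.radical), hT.quotientTrace_mk, ← _root_.map_one
      (MonoidAlgebra.of S P), linearExtension_of, hT.map_one]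
  map_mul_comm x y := by
    obtain ⟨x, rfl⟩ := Ideal.Quotient.mk_surjective x
    obtain ⟨y, rfl⟩ := Ideal.Quotient.mk_surjective y
    rw [← map_mul, ← map_mul, hT.quotientTrace_mk, hT.quotientTrace_mk, hT.linearExtension_mul_comm]
  polar x y := by
    obtain ⟨x, rfl⟩ := Ideal.Quotient.mk_surjective x
    obtain ⟨y, rfl⟩ := Ideal.Quotient.mk_surjective y
    rw [← map_mul, ← map_mul, hT.quotientTrace_mk, hT.quotientTrace_mk, hT.quotientTrace_mk]
    change Ideal.Quotient.mk hT.radical (x * y + y * x) = Ideal.Quotient.mk hT.radical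
      (linearExtension T x • y + linearExtension T y • x +
        (linearExtension T (x * y) - linearExtension T x * linearExtension T y) • 1)
    rw [Ideal.Quotient.eq, hT.mem_radical]
    intro z
    simp only [sub_mul, add_mul, smul_mul_assoc, one_mul, map_sub, map_add, map_smul, smul_eq_mul]
    have h := hT.linearExtension_triple x y z
    have h' : linearExtension T (x * z * y) = linearExtension T (y * x * z) := by
      rw [hT.linearExtension_mul_comm, mul_assoc]
    linear_combination h - h'

end TraceQuotient

/-! ### Lifting quaternion bases and pseudo-representations to matrices -/

section QuaternionLift

open Matrix

/-- Over `k` the first scalar is a quarter of `tr² - 4`. If the second vanished, the commutator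
would have square zero, hence determinant zero. -/
theorem isUnit_traceless_and_commutator {P : Type p} [Group P] {S : Type w} [CommRing S]
    [IsLocalRing S] {k : Type v} [Field k] {res : S →+* k} (hres : Function.Surjective res) {r : S}
    (hr : 2 * r = 1) {T : P → S} {ρbar : P →* Matrix.SpecialLinearGroup (Fin 2) k} (hTρ : ∀ g, res (T g) = sl2Trace ρbar g)
    {g h : P} (hg : (ρbar g : Matrix (Fin 2) (Fin 2) k).trace ^ 2 ≠ 4)
    (hgh : ((ρbar g : Matrix (Fin 2) (Fin 2) k) * (ρbar h : Matrix (Fin 2) (Fin 2) k) -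
        (ρbar h : Matrix (Fin 2) (Fin 2) k) * (ρbar g : Matrix (Fin 2) (Fin 2) k)).det ≠ 0) :
    IsUnit (tracelessSq r T g) ∧ IsUnit (commutatorSq T g h) := by
  have hr' : 2 * res r = 1 := by rw [← map_ofNat res, ← map_mul, hr, map_one]
  rw [isUnit_iff_of_surjective hres, isUnit_iff_of_surjective hres]
  constructor
  · simp only [tracelessSq, map_sub, map_mul, map_pow, map_one, hTρ]
    intro H
    apply hg
    change (sl2Trace ρbar g) ^ 2 = 4
    linear_combination 4 * H - (2 * res r + 1) * sl2Trace ρbar g ^ 2 * hr'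
  · intro H
    have h1 := ringCommutator_mul_self (isCayleyHamilton_matrix k) (isPseudoSL2Rep_sl2Trace ρbar)
      hr' (traceLinearMap_sl2Coe ρbar) g h
    have h2 : commutatorSq (sl2Trace ρbar) g h = 0 := by
      rw [← H]; simp only [commutatorSq, map_sub, hTρ]
    rw [h2, zero_smul] at h1
    have h3 := congrArg Matrix.det h1
    rw [Matrix.det_mul] at h3
    rw [Matrix.det_zero, mul_self_eq_zero] at h3
    exact hgh h3

variable {S : Type w} [CommRing S] [IsLocalRing S] [IsAdicComplete (maximalIdeal S) S]
  {k : Type v} [Field k] {res : S →+* k} (hres : Function.Surjective res)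

-- Hensel's lemma for `X² - x` at the approximate root `1`, where the derivative is the unit `2`.
include hres in
theorem exists_mul_self_eq_of_residue_eq_one (h2 : IsUnit (2 : S)) {x : S} (hx : res x = 1) :
    ∃ y, y * y = x ∧ res y = 1 := by
  obtain ⟨y, hy, hy1⟩ := HenselianRing.is_henselian (I := maximalIdeal S)
    (Polynomial.X ^ 2 - Polynomial.C x) (Polynomial.monic_X_pow_sub_C x two_ne_zero) 1
    (by simp [mem_maximalIdeal_iff_of_surjective hres, hx])
    (by simpa [one_add_one_eq_two] using h2.map (Ideal.Quotient.mk (maximalIdeal S)))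
  refine ⟨y, ?_, ?_⟩
  · simp only [Polynomial.IsRoot.def, Polynomial.eval_sub, Polynomial.eval_pow, Polynomial.eval_X,
      Polynomial.eval_C] at hy
    linear_combination hy
  · rw [mem_maximalIdeal_iff_of_surjective hres, map_sub, map_one, sub_eq_zero] at hy1
    exact hy1

theorem mapMatrix_smul {S : Type*} [CommRing S] {k : Type*} [CommRing k] (res : S →+* k) (s : S)
    (M : Matrix (Fin 2) (Fin 2) S) : res.mapMatrix (s • M) = res s • res.mapMatrix M := by
  ext; simp

theorem mul_self_of_trace_eq_zero {S : Type*} [CommRing S] {M : Matrix (Fin 2) (Fin 2) S}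
    (hM : M.trace = 0) : M * M = (-M.det) • 1 := by
  rw [Matrix.trace_fin_two] at hM
  have h : M 1 1 = - M 0 0 := by linear_combination hM
  ext i j
  fin_cases i <;> fin_cases j <;>
    simp [Matrix.mul_apply, Fin.sum_univ_two, Matrix.det_fin_two, h] <;> ring

include hres in
/-- A traceless lift of a square root of a scalar can be rescaled to a square root of a lift of that
scalar. -/
theorem exists_smul_mul_self_eq (h2 : IsUnit (2 : S)) {M : Matrix (Fin 2) (Fin 2) S}
    (hM : M.trace = 0) {a : S} (ha : res a ≠ 0)
    (hMa : res.mapMatrix M * res.mapMatrix M = res a • 1) :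
    ∃ u, res u = 1 ∧ (u • M) * (u • M) = a • 1 := by
  have hMM := mul_self_of_trace_eq_zero hM
  have hb : res (-M.det) = res a := by
    rw [← map_mul, hMM, mapMatrix_smul, map_one] at hMa
    simpa using congrFun (congrFun hMa 0) 0
  generalize -M.det = b at *
  obtain ⟨b', hb'⟩ := ((isUnit_iff_of_surjective hres b).mpr (hb ▸ ha)).exists_right_inv
  -- Since `M * M` is the scalar `b`, the scaling factor is a square root of `a / b`, which is
  -- congruent to `1`.
  obtain ⟨u, hu, hu1⟩ := exists_mul_self_eq_of_residue_eq_one hres h2 (x := a * b') (by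
    rw [map_mul, ← hb, ← map_mul, hb', map_one])
  refine ⟨u, hu1, ?_⟩
  rw [smul_mul_smul_comm, hMM, smul_smul, hu]
  congr 1
  linear_combination a * hb'

theorem exists_matrix_lift {S : Type*} [CommRing S] {k : Type*} [CommRing k] {res : S →+* k}
    (hres : Function.Surjective res) (M : Matrix (Fin 2) (Fin 2) k) :
    ∃ N : Matrix (Fin 2) (Fin 2) S, res.mapMatrix N = M := by
  choose f hf using hres
  exact ⟨M.map f, by ext; simp [hf]⟩

include hres in
/-- Anticommuting square roots of scalars lift along the residue map. -/
theorem exists_anticommuting_lift {r : S} (hr : 2 * r = 1) {i j : Matrix (Fin 2) (Fin 2) k}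
    {a c : S} (ha : res a ≠ 0) (hc : res c ≠ 0) (hi : i * i = res a • 1) (hj : j * j = res c • 1)
    (hij : i * j = -(j * i)) :
    ∃ I J : Matrix (Fin 2) (Fin 2) S, res.mapMatrix I = i ∧ res.mapMatrix J = j ∧
      I * I = a • 1 ∧ J * J = c • 1 ∧ I * J = -(J * I) := by
  have h2 : IsUnit (2 : S) := .of_mul_eq_one _ hr
  have hr' : 2 * res r = 1 := by rw [← map_ofNat res, ← map_mul, hr, map_one]
  have hti : i.trace = 0 := (isCayleyHamilton_matrix k).trace_eq_zero_of_anticomm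
    (.of_mul_eq_one _ hr') hc.isUnit hj hij
  have hua := (isUnit_iff_of_surjective hres a).mpr ha
  obtain ⟨I₁, hI₁⟩ := exists_matrix_lift hres i
  let I₀ := I₁ - (r * I₁.trace) • 1
  have hI₀ : I₀.trace = 0 := by
    simp only [I₀, Matrix.trace_sub, Matrix.trace_smul, Matrix.trace_one, Fintype.card_fin,
      smul_eq_mul, Nat.cast_ofNat]
    linear_combination -I₁.trace * hr
  have hI₀i : res.mapMatrix I₀ = i := by
    have : res I₁.trace = 0 := by
      rw [← hti, ← hI₁]
      simp [Matrix.trace_fin_two]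
    rw [map_sub, mapMatrix_smul, map_mul, this, hI₁]
    simp
  obtain ⟨u, hu, hI⟩ := exists_smul_mul_self_eq hres h2 hI₀ ha (by rw [hI₀i, hi])
  set I := u • I₀ with hIdef
  have hIi : res.mapMatrix I = i := by rw [hIdef, mapMatrix_smul, hu, one_smul, hI₀i]
  obtain ⟨J₁, hJ₁⟩ := exists_matrix_lift hres j
  obtain ⟨a', ha'⟩ := hua.exists_right_inv
  -- This is the projection `(J₁ - I J₁ I⁻¹) / 2` onto the matrices anticommuting with `I`. It does
  -- not change the reduction, because `j` already anticommutes with `i`.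
  let J₀ := r • (J₁ - a' • (I * J₁ * I))
  have hJ₀j : res.mapMatrix J₀ = j := by
    have h1 : i * j * i = -(res a • j) := by
      rw [hij, neg_mul, mul_assoc, hi]; simp
    rw [mapMatrix_smul, map_sub, mapMatrix_smul, map_mul, map_mul, hIi, hJ₁, h1, smul_neg,
      smul_smul, ← map_mul, mul_comm a', ha', map_one, one_smul, sub_neg_eq_add, ← two_smul k,
      smul_smul, mul_comm, hr', one_smul]
  have hIJ₀ : I * J₀ = -(J₀ * I) := by
    have h1 : a' • (I * (I * J₁ * I)) = J₁ * I := by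
      rw [← mul_assoc, ← mul_assoc, hI, smul_one_mul, smul_mul_assoc, smul_smul, mul_comm, ha',
        one_smul]
    have h2 : a' • (I * J₁ * I * I) = I * J₁ := by
      rw [mul_assoc _ I I, hI, mul_smul_one, smul_smul, mul_comm, ha', one_smul]
    simp only [J₀, mul_smul_comm, smul_mul_assoc, mul_sub, sub_mul, h1, h2]
    rw [← smul_neg, neg_sub]
  have hJ₀ : J₀.trace = 0 := (isCayleyHamilton_matrix S).trace_eq_zero_of_anticomm
    h2 hua hI (by rw [hIJ₀, neg_neg])
  obtain ⟨t, ht, hJ⟩ := exists_smul_mul_self_eq hres h2 hJ₀ hc (by rw [hJ₀j, hj])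
  clear_value J₀
  refine ⟨I, t • J₀, hIi, by rw [mapMatrix_smul, ht, one_smul, hJ₀j], hI, hJ, ?_⟩
  rw [mul_smul_comm, hIJ₀, smul_mul_assoc, smul_neg]

variable {P : Type p} [Group P]

include hres in
/-- A pseudo-`SL₂`-representation over a complete local ring lifting the trace of `ρbar` is the
trace of a lift of `ρbar`, if some pair of elements generates the matrix algebra. -/
theorem IsPseudoSL2Rep.exists_lift {r : S} (hr : 2 * r = 1) {T : P → S} (hT : IsPseudoSL2Rep T)
    {ρbar : P →* Matrix.SpecialLinearGroup (Fin 2) k} (hTρ : ∀ g, res (T g) = sl2Trace ρbar g)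
    {g h : P} (ha : IsUnit (tracelessSq r T g)) (hc : IsUnit (commutatorSq T g h)) :
    ∃ ρ : P →* Matrix.SpecialLinearGroup (Fin 2) S, sl2Trace ρ = T ∧
      (Matrix.SpecialLinearGroup.map res).comp ρ = ρbar := by
  have h2 : IsUnit (2 : S) := .of_mul_eq_one _ hr
  have hr' : 2 * res r = 1 := by rw [← map_ofNat res, ← map_mul, hr, _root_.map_one]
  have hTb := isPseudoSL2Rep_sl2Trace ρbar
  have hra : res (tracelessSq r T g) = tracelessSq (res r) (sl2Trace ρbar) g := by
    simp [tracelessSq, hTρ]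
  have hrc : res (commutatorSq T g h) = commutatorSq (sl2Trace ρbar) g h := by
    simp [commutatorSq, hTρ]
  have ha' := (isUnit_iff_of_surjective hres _).mp ha
  have hc' := (isUnit_iff_of_surjective hres _).mp hc
  have htk := isCayleyHamilton_matrix k
  have hιk := traceLinearMap_sl2Coe ρbar
  obtain ⟨I, J, hIi, hJj, hI, hJ, hIJ⟩ := exists_anticommuting_lift hres hr ha' hc'
    (by rw [hra]; exact tracelessPart_mul_self htk hTb hr' hιk g)
    (by rw [hrc]; exact ringCommutator_mul_self htk hTb hr' hιk g h)
    (tracelessPart_mul_ringCommutator htk hTb hr' hιk g h)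
  let ι : P →* MonoidAlgebra S P ⧸ hT.radical :=
    (Ideal.Quotient.mk hT.radical : MonoidAlgebra S P →* _).comp (MonoidAlgebra.of S P)
  have hι : ∀ g, hT.quotientTrace (ι g) = T g := fun g => linearExtension_of T g
  have ht := hT.isCayleyHamilton_quotientTrace
  obtain ⟨Φ, hΦi, hΦj, hΦ⟩ := ht.exists_algHom (isCayleyHamilton_matrix S) h2 ha hc
    (tracelessPart_mul_self ht hT hr hι g) (ringCommutator_mul_self ht hT hr hι g h)
    (tracelessPart_mul_ringCommutator ht hT hr hι g h) hI hJ hIJ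
  have htr : ∀ b, (Φ (ι b)).trace = T b := fun b => (hΦ _).trans (hι b)
  -- For `2 × 2` matrices `tr(X)² - tr(X²) = 2 det X`, so the last axiom of a pseudo-representation
  -- is the determinant condition.
  have hdet : ∀ b, (Φ (ι b)).det = 1 := by
    intro b
    have h := hT.sq_sub b
    rw [← htr, ← htr, pow_two b, map_mul, map_mul] at h
    simp only [Matrix.trace_fin_two, Matrix.mul_apply, Fin.sum_univ_two] at h
    rw [Matrix.det_fin_two]
    apply h2.mul_left_cancel
    linear_combination h
  let ρ : P →* Matrix.SpecialLinearGroup (Fin 2) S :=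
    { toFun := fun b => ⟨Φ (ι b), hdet b⟩
      map_one' := Subtype.ext (by simp)
      map_mul' := fun b b' => Subtype.ext (by
        change Φ (ι (b * b')) = Φ (ι b) * Φ (ι b')
        rw [map_mul, map_mul]) }
  have hρ : sl2Trace ρ = T := funext htr
  have hρi : tracelessPart r T (sl2Coe ρ) g = I := by
    rw [← hΦi]
    simp only [tracelessPart, map_sub, map_smul, _root_.map_one]
    rfl
  have hρj : ringCommutator (sl2Coe ρ) g h = J := by
    rw [← hΦj]
    simp only [ringCommutator, map_sub, map_mul]
    rfl
  refine ⟨ρ, hρ, MonoidHom.ext fun b => Subtype.ext ?_⟩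
  change res.mapMatrix (sl2Coe ρ b) = sl2Coe ρbar b
  -- The reduction of `ρ` and `ρbar` have the same expansion in the same quaternion basis, with
  -- coefficients given by the same traces.
  have h1 := congrArg res.mapMatrix (sl2Coe_expansion hr hρ ha hc b)
  have h2 := sl2Coe_expansion hr' (ρ := ρbar) rfl (hra ▸ ha'.isUnit) (hrc ▸ hc'.isUnit) b
  simp only [hρi, hρj, map_add, map_sub, map_mul, mapMatrix_smul, hIi, hJj,
    _root_.map_one, hTρ, hra, hrc, map_ofNat] at h1
  rw [← h2] at h1
  refine smul_right_injective _ ?_ h1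
  rw [hra] at ha'
  rw [hrc] at hc'
  exact mul_ne_zero (mul_ne_zero (left_ne_zero_of_mul_eq_one hr') ha') hc'

end QuaternionLift

/-! ### The universal ring of pseudo-representations -/

section UniversalRing

variable (O : Type u) [CommRing O] (P : Type p) [Group P]

open MvPolynomial in
/-- The defining relations of a pseudo-`SL₂`-representation. -/
def pseudoSL2Relations : Set (MvPolynomial P O) :=
  {f | f = X 1 - 2 ∨ (∃ g₁ g₂, f = X (g₁ * g₂) - X (g₂ * g₁)) ∨
    (∃ g₁ g₂ g₃, f = X g₁ * X g₂ * X g₃ + X (g₁ * g₂ * g₃) + X (g₁ * g₃ * g₂)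
      - X (g₁ * g₂) * X g₃ - X (g₂ * g₃) * X g₁ - X (g₁ * g₃) * X g₂) ∨
    ∃ g, f = X g ^ 2 - X (g ^ 2) - 2}

/-- The universal ring of pseudo-`SL₂`-representations. -/
abbrev PseudoSL2Ring : Type (max u p) := MvPolynomial P O ⧸ Ideal.span (pseudoSL2Relations O P)

variable {P}

/-- The universal pseudo-`SL₂`-representation. -/
noncomputable def universalPseudoSL2 (g : P) : PseudoSL2Ring O P :=
  Ideal.Quotient.mk _ (MvPolynomial.X g)

variable {O}

theorem mk_pseudoSL2Relation_eq_zero {f : MvPolynomial P O} (hf : f ∈ pseudoSL2Relations O P) :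
    Ideal.Quotient.mk (Ideal.span (pseudoSL2Relations O P)) f = 0 :=
  Ideal.Quotient.eq_zero_iff_mem.mpr (Ideal.subset_span hf)

variable (O P) in
theorem isPseudoSL2Rep_universalPseudoSL2 :
    IsPseudoSL2Rep (universalPseudoSL2 O : P → PseudoSL2Ring O P) where
  map_one := by
    have := mk_pseudoSL2Relation_eq_zero (O := O) (P := P) (.inl rfl)
    rwa [map_sub, map_ofNat, sub_eq_zero] at this
  map_mul_comm g₁ g₂ := by
    have := mk_pseudoSL2Relation_eq_zero (O := O) (P := P) (.inr (.inl ⟨g₁, g₂, rfl⟩))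
    rwa [map_sub, sub_eq_zero] at this
  triple g₁ g₂ g₃ := by
    have := mk_pseudoSL2Relation_eq_zero (O := O) (P := P) (.inr (.inr (.inl ⟨g₁, g₂, g₃, rfl⟩)))
    simp only [map_sub, map_add, map_mul] at this
    exact this
  sq_sub g := by
    have := mk_pseudoSL2Relation_eq_zero (O := O) (P := P) (.inr (.inr (.inr ⟨g, rfl⟩)))
    rwa [map_sub, map_ofNat, sub_eq_zero, map_sub, map_pow] at this

theorem exists_algHom_of_isPseudoSL2Rep {S : Type w} [CommRing S] [Algebra O S] {T : P → S}
    (hT : IsPseudoSL2Rep T) :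
    ∃ φ : PseudoSL2Ring O P →ₐ[O] S, ∀ g, φ (universalPseudoSL2 O g) = T g := by
  refine ⟨Ideal.Quotient.liftₐ _ (MvPolynomial.aeval T) ?_, fun g => ?_⟩
  · intro a ha
    rw [← RingHom.mem_ker]
    revert a
    change _ ≤ RingHom.ker (MvPolynomial.aeval (R := O) T)
    rw [Ideal.span_le]
    rintro f (rfl | ⟨g₁, g₂, rfl⟩ | ⟨g₁, g₂, g₃, rfl⟩ | ⟨g, rfl⟩)
    · simp [RingHom.mem_ker, hT.map_one]
    · simp [RingHom.mem_ker, hT.map_mul_comm g₁ g₂]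
    · simpa [RingHom.mem_ker] using hT.triple g₁ g₂ g₃
    · simp [RingHom.mem_ker, hT.sq_sub g]
  · change MvPolynomial.aeval T (MvPolynomial.X g) = _
    rw [MvPolynomial.aeval_X]

variable (O P) in
theorem adjoin_range_universalPseudoSL2 :
    Algebra.adjoin O (Set.range (universalPseudoSL2 O : P → PseudoSL2Ring O P)) = ⊤ := by
  have h : Set.range (universalPseudoSL2 O : P → PseudoSL2Ring O P) =
      Ideal.Quotient.mkₐ O _ '' Set.range MvPolynomial.X := by
    rw [← Set.range_comp]; rfl
  rw [h, ← AlgHom.map_adjoin, MvPolynomial.adjoin_range_X, Algebra.map_top,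
    AlgHom.range_eq_top]
  exact Ideal.Quotient.mkₐ_surjective _ _

theorem algHom_ext_universalPseudoSL2 {S : Type w} [CommRing S] [Algebra O S]
    {φ ψ : PseudoSL2Ring O P →ₐ[O] S}
    (h : ∀ g, φ (universalPseudoSL2 O g) = ψ (universalPseudoSL2 O g)) : φ = ψ := by
  apply AlgHom.ext_of_adjoin_eq_top (adjoin_range_universalPseudoSL2 O P)
  rintro _ ⟨g, rfl⟩
  exact h g

theorem finiteType_pseudoSL2Ring [Group.FG P] (h2 : IsUnit (2 : O)) :
    Algebra.FiniteType O (PseudoSL2Ring O P) := by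
  have h2' : IsUnit (2 : PseudoSL2Ring O P) := by
    simpa only [map_ofNat] using h2.map (algebraMap O (PseudoSL2Ring O P))
  obtain ⟨F, hF, hFT⟩ := (isPseudoSL2Rep_universalPseudoSL2 O P).exists_finset_adjoin (O := O) h2'
  refine ⟨⟨hF.toFinset, ?_⟩⟩
  rw [hF.coe_toFinset, eq_top_iff, ← adjoin_range_universalPseudoSL2 O P]
  apply Algebra.adjoin_le
  rintro _ ⟨g, rfl⟩
  exact hFT g

end UniversalRing

/-! ### Completion at a `k`-point -/

section Completion

variable {O : Type u} [CommRing O] {k : Type v} [Field k] [Algebra O k]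
  {B : Type w} [CommRing B] [Algebra O B]

namespace CompleteLocalAlg

theorem mem_maximalIdeal_iff (R : CompleteLocalAlg.{u, v, w} O k) (x : R) :
    x ∈ maximalIdeal R ↔ R.residue x = 0 :=
  mem_maximalIdeal_iff_of_surjective (res := (R.residue : R →+* k)) R.residue_surjective x

theorem Hom.map_mem_maximalIdeal_pow {R : CompleteLocalAlg.{u, v, w} O k}
    {S : CompleteLocalAlg.{u, v, w'} O k} (ψ : R.Hom S) (n : ℕ) {y : R}
    (hy : y ∈ maximalIdeal R ^ n) : ψ.1 y ∈ maximalIdeal S ^ n := by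
  suffices h : maximalIdeal R ^ n ≤ (maximalIdeal S ^ n).comap (ψ.1 : R →+* S) from h hy
  refine le_trans (Ideal.pow_right_mono (fun x hx => ?_) n) (Ideal.le_comap_pow _ n)
  rw [R.mem_maximalIdeal_iff] at hx
  rw [Ideal.mem_comap, S.mem_maximalIdeal_iff, ← hx]
  exact DFunLike.congr_fun ψ.2 x

theorem eq_of_forall_mk_pow_eq {S : Type*} [CommRing S] (I : Ideal S) [IsHausdorff I S] {x y : S}
    (h : ∀ n, Ideal.Quotient.mk (I ^ n) x = Ideal.Quotient.mk (I ^ n) y) : x = y := by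
  rw [← sub_eq_zero]
  apply IsHausdorff.haus ‹IsHausdorff I S›
  intro n
  rw [SModEq.zero, smul_eq_mul, Ideal.mul_top, ← Ideal.Quotient.eq]
  exact h n

/-- As `p` is finitely generated, the kernel of evaluation at level `n` is generated by `p ^ n`.
This makes elements of `B` approximate `x` in the adic topology of the completion. -/
theorem sub_mem_map_pow_of_evalₐ_eq {p : Ideal B} (hfg : p.FG) {n : ℕ} {x : AdicCompletion p B}
    {b : B} (h : AdicCompletion.evalₐ p n x = Ideal.Quotient.mk _ b) :
    x - algebraMap B _ b ∈ p.map (algebraMap B (AdicCompletion p B)) ^ n := by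
  rw [← Ideal.map_pow, ← Submodule.restrictScalars_mem B, ← Ideal.smul_top_eq_map,
    AdicCompletion.pow_smul_top_eq_ker_eval hfg, LinearMap.mem_ker, AdicCompletion.eval_apply]
  have h' : AdicCompletion.evalₐ p n (x - algebraMap B _ b) = 0 := by
    rw [map_sub, h, AlgHom.commutes]
    exact sub_self _
  have := AdicCompletion.factor_evalₐ_eq_eval (I := p) (n := n) (x - algebraMap B _ b) (by simp)
  rw [h', map_zero] at this
  exact this.symm

/-- An algebra homomorphism to a complete local algebra extends to the adic completion. -/
theorem exists_adicCompletion_lift (π : B →ₐ[O] k) (S : CompleteLocalAlg.{u, v, w'} O k)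
    (f : B →ₐ[O] S) (hf : ∀ b, S.residue (f b) = π b) :
    ∃ ψ : AdicCompletion (RingHom.ker π) B →+* S,
      (∀ b, ψ (algebraMap B _ b) = f b) ∧
      ∀ x b, AdicCompletion.evalOneₐ (RingHom.ker π) x = Ideal.Quotient.mk _ b →
        S.residue (ψ x) = π b := by
  have hle : ∀ n, RingHom.ker π ^ n ≤ (maximalIdeal S ^ n).comap (f : B →+* S) := by
    intro n
    refine le_trans (Ideal.pow_right_mono ?_ n) (Ideal.le_comap_pow _ n)
    intro b hb
    rw [Ideal.mem_comap, S.mem_maximalIdeal_iff]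
    exact (hf b).trans hb
  -- The maps through `B ⧸ p ^ n` to `S ⧸ m ^ n`, with `p` the kernel of `π`, are compatible and
  -- glue because `S` is complete.
  let F : ∀ n, AdicCompletion (RingHom.ker π) B →+* S ⧸ maximalIdeal S ^ n := fun n =>
    (Ideal.quotientMap _ (f : B →+* S) (hle n)).comp
      (AdicCompletion.evalₐ (RingHom.ker π) n : _ →+* _)
  have hF : ∀ {m n : ℕ} (h : m ≤ n), (Ideal.Quotient.factorPow (maximalIdeal S) h).comp (F n) =
      F m := by
    intro m n h
    ext x
    obtain ⟨x, rfl⟩ := AdicCompletion.mk_surjective _ _ x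
    have hx := AdicCompletion.Ideal.mk_eq_mk _ h x
    rw [Ideal.Quotient.eq] at hx
    simp only [F, RingHom.comp_apply, RingHom.coe_coe, AdicCompletion.evalₐ_mk,
      Ideal.quotientMap_mk]
    change Ideal.Quotient.mk (maximalIdeal S ^ m) (f (x n)) = Ideal.Quotient.mk _ (f (x m))
    rw [Ideal.Quotient.eq, ← map_sub]
    exact hle m hx
  let ψ := IsAdicComplete.liftRingHom (maximalIdeal S) F hF
  have hψ : ∀ n x, Ideal.Quotient.mk (maximalIdeal S ^ n) (ψ x) = F n x :=
    fun n x => IsAdicComplete.mk_liftRingHom _ _ _ n x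
  refine ⟨ψ, fun b => ?_, fun x b hx => ?_⟩
  · apply eq_of_forall_mk_pow_eq (maximalIdeal S)
    intro n
    rw [hψ]
    change Ideal.quotientMap (maximalIdeal S ^ n) (f : B →+* S) (hle n)
      (AdicCompletion.evalₐ (RingHom.ker π) n (algebraMap B _ b)) = _
    rw [AlgHom.commutes, Ideal.Quotient.algebraMap_eq, Ideal.quotientMap_mk]
    rfl
  · obtain ⟨b', hb'⟩ := Ideal.Quotient.mk_surjective (AdicCompletion.evalₐ (RingHom.ker π) 1 x)
    have h1 : π b' = π b := by
      rw [← AdicCompletion.factorₐ_evalₐ_one, ← hb'] at hx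
      have : b' - b ∈ RingHom.ker π := Ideal.Quotient.eq.mp hx
      rwa [RingHom.mem_ker, map_sub, sub_eq_zero] at this
    have h2 : ψ x - f b' ∈ maximalIdeal S ^ 1 := by
      rw [← Ideal.Quotient.eq, hψ]
      change Ideal.quotientMap (maximalIdeal S ^ 1) (f : B →+* S) (hle 1)
        (AdicCompletion.evalₐ (RingHom.ker π) 1 x) = _
      rw [← hb', Ideal.quotientMap_mk]
      rfl
    rw [pow_one, S.mem_maximalIdeal_iff, map_sub, sub_eq_zero] at h2
    rw [h2, hf, h1]

/-- The completion of an algebra at a `k`-point. -/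
theorem exists_completion [IsNoetherianRing B] (π : B →ₐ[O] k) (hπ : Function.Surjective π) :
    ∃ (R : CompleteLocalAlg.{u, v, w} O k) (ι : B →ₐ[O] R), (∀ b, R.residue (ι b) = π b) ∧
      ∀ (S : CompleteLocalAlg.{u, v, w'} O k) (f : B →ₐ[O] S), (∀ b, S.residue (f b) = π b) →
        ∃! ψ : R.Hom S, ∀ b, ψ.1 (ι b) = f b := by
  let p := RingHom.ker π
  have hp : p.IsMaximal := RingHom.ker_isMaximal_of_surjective (π : B →+* k) hπ
  have hfg : p.FG := p.fg_of_isNoetherianRing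
  have hmax := AdicCompletion.isMaximal_map_of_le p p le_rfl hfg
  have hcomp := AdicCompletion.isAdicComplete_self p hfg
  have hloc := isLocalRing_of_isAdicComplete_maximal
    (p.map (algebraMap B (AdicCompletion p B)))
  have hm := IsLocalRing.eq_maximalIdeal hmax
  rw [hm] at hcomp
  let res : AdicCompletion p B →ₐ[O] k :=
    (Ideal.Quotient.liftₐ p π (fun a ha => ha)).comp
      ((AdicCompletion.evalOneₐ p).restrictScalars O)
  have hres : ∀ b, res (algebraMap B _ b) = π b := fun b => rfl
  let R : CompleteLocalAlg.{u, v, w} O k :=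
    { carrier := AdicCompletion p B
      residue := res
      residue_surjective := fun x => by
        obtain ⟨b, rfl⟩ := hπ x
        exact ⟨_, hres b⟩ }
  refine ⟨R, IsScalarTower.toAlgHom O B (AdicCompletion p B), hres, fun S f hf => ?_⟩
  obtain ⟨ψ, hψ, hψ'⟩ := exists_adicCompletion_lift π S f hf
  let Ψ : AdicCompletion p B →ₐ[O] S :=
    { ψ with
      commutes' := fun o => by
        change ψ (algebraMap O (AdicCompletion p B) o) = _
        rw [IsScalarTower.algebraMap_apply O B (AdicCompletion p B), hψ, AlgHom.commutes] }
  have hΨ : S.residue.comp Ψ = R.residue := AlgHom.ext fun x => by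
    obtain ⟨b, hb⟩ := Ideal.Quotient.mk_surjective (AdicCompletion.evalOneₐ p x)
    refine (hψ' x b hb.symm).trans ?_
    change _ = Ideal.Quotient.liftₐ p π (fun a ha => ha) (AdicCompletion.evalOneₐ p x)
    rw [← hb]
    rfl
  refine ⟨⟨Ψ, hΨ⟩, hψ, fun φ hφ => Subtype.ext (AlgHom.ext fun x => ?_)⟩
  apply eq_of_forall_mk_pow_eq (maximalIdeal S)
  intro n
  obtain ⟨b, hb⟩ := Ideal.Quotient.mk_surjective (AdicCompletion.evalₐ p n x)
  have hx := sub_mem_map_pow_of_evalₐ_eq hfg hb.symm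
  rw [hm] at hx
  -- Morphisms respect powers of the maximal ideals, so modulo the `n`-th power the value at `x` is
  -- forced by the approximation `b`.
  have key : ∀ χ : R.Hom S, (∀ b, χ.1 (algebraMap B (AdicCompletion p B) b) = f b) →
      Ideal.Quotient.mk (maximalIdeal S ^ n) (χ.1 x) = Ideal.Quotient.mk _ (f b) := by
    intro χ hχ
    have h := χ.map_mem_maximalIdeal_pow n hx
    rw [Ideal.Quotient.eq, ← hχ b, ← map_sub]
    exact h
  exact (key φ hφ).trans (key ⟨Ψ, hΨ⟩ hψ).symm

end CompleteLocalAlg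

end Completion

/-! ### Comparison of the two deformation problems -/

section UniversalDeformation

open Matrix

variable {O : Type u} {k : Type v} [CommRing O] [Field k] [Algebra O k] {P : Type p} [Group P]

/-- A pseudo-`SL₂`-representation of a finitely generated group over the residue field of a
Noetherian ring in which `2` is invertible has a universal deformation. -/
theorem exists_isUniversalPseudoDeformation [IsNoetherianRing O] [Group.FG P]
    (hk : Function.Surjective (algebraMap O k)) (h2 : IsUnit (2 : O)) {Tbar : P → k}
    (hT : IsPseudoSL2Rep Tbar) :
    ∃ (R : CompleteLocalAlg.{u, v, u} O k) (T : P → R),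
      IsUniversalPseudoDeformation.{u, v, u, w', p} Tbar R T := by
  obtain ⟨n, f, hf⟩ := Algebra.FiniteType.iff_quotient_mvPolynomial''.mp
    (finiteType_pseudoSL2Ring (P := P) h2)
  -- Replacing the universal ring by a quotient of a polynomial ring in finitely many variables
  -- makes it Noetherian and places it in the universe of `O`.
  let e := Ideal.quotientKerAlgEquivOfSurjective hf
  obtain ⟨φ, hφ⟩ := exists_algHom_of_isPseudoSL2Rep (O := O) hT
  obtain ⟨R, ι, hι, hR⟩ := CompleteLocalAlg.exists_completion.{u, v, u, w'}
    (φ.comp e.toAlgHom) (fun x => by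
      obtain ⟨o, rfl⟩ := hk x
      exact ⟨algebraMap O _ o, AlgHom.commutes _ o⟩)
  have huniv := isPseudoSL2Rep_universalPseudoSL2 O P
  refine ⟨R, fun g => ι (e.symm (universalPseudoSL2 O g)),
    ⟨huniv.map ((ι.comp e.symm.toAlgHom : _ →ₐ[O] R) : _ →+* R), fun g => ?_⟩, ?_⟩
  · rw [hι, ← hφ]
    exact congrArg φ (e.apply_symm_apply _)
  · intro S T' hT'
    obtain ⟨χ, hχ⟩ := exists_algHom_of_isPseudoSL2Rep (O := O) hT'.1
    have hres : S.residue.comp χ = φ := algHom_ext_universalPseudoSL2 fun g => by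
      rw [hφ, ← hT'.2 g, ← hχ]; rfl
    obtain ⟨ψ, hψ, huniq⟩ := hR S (χ.comp e.toAlgHom) (fun b => DFunLike.congr_fun hres (e b))
    refine ⟨ψ, fun g => ?_, fun ψ' hψ' => huniq ψ' fun b => ?_⟩
    · rw [hψ, ← hχ]
      exact congrArg χ (e.apply_symm_apply _)
    · have h : (ψ'.1.comp ι).comp e.symm.toAlgHom = χ := algHom_ext_universalPseudoSL2 fun g =>
        (hψ' g).trans (hχ g).symm
      rw [← h]
      exact congrArg (fun b => ψ'.1 (ι b)) (e.symm_apply_apply b).symm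

theorem CompleteLocalAlg.exists_two_mul_eq_one (hchar : (2 : k) ≠ 0)
    (S : CompleteLocalAlg.{u, v, w} O k) : ∃ r : S, 2 * r = 1 :=
  ((isUnit_iff_of_surjective (res := (S.residue : S →+* k)) S.residue_surjective 2).mpr (by
    rwa [map_ofNat])).exists_right_inv

variable {ρbar : P →* Matrix.SpecialLinearGroup (Fin 2) k}

theorem IsSL2Deformation.residue_sl2Trace {S : CompleteLocalAlg.{u, v, w} O k}
    {ρ : P →* Matrix.SpecialLinearGroup (Fin 2) S} (h : IsSL2Deformation ρbar S ρ) (g : P) :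
    S.residue (sl2Trace ρ g) = sl2Trace ρbar g := by
  rw [← h]
  simp [sl2Trace, Matrix.trace_fin_two]

theorem IsSL2Deformation.isPseudoDeformation {S : CompleteLocalAlg.{u, v, w} O k}
    {ρ : P →* Matrix.SpecialLinearGroup (Fin 2) S} (h : IsSL2Deformation ρbar S ρ) :
    IsPseudoDeformation (sl2Trace ρbar) S (sl2Trace ρ) :=
  ⟨isPseudoSL2Rep_sl2Trace ρ, h.residue_sl2Trace⟩

theorem IsSL2Deformation.map {R : CompleteLocalAlg.{u, v, w} O k}
    {S : CompleteLocalAlg.{u, v, w'} O k} {ρ : P →* Matrix.SpecialLinearGroup (Fin 2) R}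
    (h : IsSL2Deformation ρbar R ρ) (ψ : R.Hom S) :
    IsSL2Deformation ρbar S ((Matrix.SpecialLinearGroup.map (ψ.1 : R →+* S)).comp ρ) := by
  rw [IsSL2Deformation, ← h]
  ext g i j
  exact DFunLike.congr_fun ψ.2 _

theorem sl2Trace_map {A : Type*} {B : Type*} [CommRing A] [CommRing B] (f : A →+* B)
    (ρ : P →* Matrix.SpecialLinearGroup (Fin 2) A) (g : P) :
    sl2Trace ((Matrix.SpecialLinearGroup.map f).comp ρ) g = f (sl2Trace ρ g) := by
  simp [sl2Trace, Matrix.trace_fin_two]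

theorem SL2StrictEquiv.sl2Trace_eq {A : Type*} [CommRing A] [IsLocalRing A]
    {ρ ρ' : P →* Matrix.SpecialLinearGroup (Fin 2) A} (h : SL2StrictEquiv ρ ρ') :
    sl2Trace ρ = sl2Trace ρ' := by
  obtain ⟨γ, -, hγ⟩ := h
  funext g
  rw [sl2Trace, sl2Trace, hγ, mul_assoc, Matrix.trace_mul_comm, mul_assoc, ← Units.val_mul,
    mul_inv_cancel, Units.val_one, mul_one]

theorem IsPseudoDeformation.exists_isSL2Deformation (hchar : (2 : k) ≠ 0)
    (hρ : IsAbsolutelyIrreducibleSL2 ρbar) {S : CompleteLocalAlg.{u, v, w} O k} {T : P → S}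
    (hT : IsPseudoDeformation (sl2Trace ρbar) S T) :
    ∃ ρ : P →* Matrix.SpecialLinearGroup (Fin 2) S, sl2Trace ρ = T ∧ IsSL2Deformation ρbar S ρ := by
  obtain ⟨r, hr⟩ := S.exists_two_mul_eq_one hchar
  obtain ⟨g, h, hg, hgh⟩ := hρ.exists_generic_pair hchar
  obtain ⟨ha, hc⟩ := isUnit_traceless_and_commutator (res := (S.residue : S →+* k))
    S.residue_surjective hr hT.2 hg hgh
  exact hT.1.exists_lift (res := (S.residue : S →+* k)) S.residue_surjective hr hT.2 ha hc

/-- This turns uniqueness up to strict equivalence into equality of traces, which is what makes the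
two universal properties interchangeable. -/
theorem IsSL2Deformation.strictEquiv_iff (hchar : (2 : k) ≠ 0)
    (hρ : IsAbsolutelyIrreducibleSL2 ρbar) {S : CompleteLocalAlg.{u, v, w} O k}
    {ρ ρ' : P →* Matrix.SpecialLinearGroup (Fin 2) S} (h : IsSL2Deformation ρbar S ρ)
    (h' : IsSL2Deformation ρbar S ρ') : SL2StrictEquiv ρ ρ' ↔ sl2Trace ρ = sl2Trace ρ' := by
  refine ⟨SL2StrictEquiv.sl2Trace_eq, fun htr => ?_⟩
  obtain ⟨r, hr⟩ := S.exists_two_mul_eq_one hchar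
  obtain ⟨g, y, hg, hgy⟩ := hρ.exists_generic_pair hchar
  obtain ⟨ha, hc⟩ := isUnit_traceless_and_commutator (res := (S.residue : S →+* k))
    S.residue_surjective hr h'.residue_sl2Trace hg hgy
  refine sl2StrictEquiv_of_sl2Trace_eq (res := (S.residue : S →+* k)) S.residue_surjective hr htr
    rfl (fun b => ?_) ha hc
  exact congrArg Subtype.val (DFunLike.congr_fun (h.trans h'.symm) b)

/-- A deformation of an absolutely irreducible representation is universal if and only if its trace
is a universal deformation of the trace. -/
theorem IsSL2Deformation.isUniversal_iff (hchar : (2 : k) ≠ 0)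
    (hρ : IsAbsolutelyIrreducibleSL2 ρbar) {R : CompleteLocalAlg.{u, v, w} O k}
    {ρ : P →* Matrix.SpecialLinearGroup (Fin 2) R} (h : IsSL2Deformation ρbar R ρ) :
    IsUniversalSL2Deformation.{u, v, w, w', p} ρbar R ρ ↔
      IsUniversalPseudoDeformation.{u, v, w, w', p} (sl2Trace ρbar) R (sl2Trace ρ) := by
  have key : ∀ (S : CompleteLocalAlg.{u, v, w'} O k)
      (ρ' : P →* Matrix.SpecialLinearGroup (Fin 2) S), IsSL2Deformation ρbar S ρ' →
      ∀ ψ : R.Hom S, SL2StrictEquiv ((Matrix.SpecialLinearGroup.map (ψ.1 : R →+* S)).comp ρ) ρ' ↔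
        ∀ g, ψ.1 (sl2Trace ρ g) = sl2Trace ρ' g := by
    intro S ρ' hρ' ψ
    rw [(h.map ψ).strictEquiv_iff hchar hρ hρ', funext_iff]
    exact forall_congr' fun g => by rw [sl2Trace_map]; rfl
  constructor
  · rintro ⟨-, huniv⟩
    refine ⟨h.isPseudoDeformation, fun S T' hT' => ?_⟩
    obtain ⟨ρ', rfl, hρ'⟩ := hT'.exists_isSL2Deformation hchar hρ
    simpa only [key S ρ' hρ'] using huniv S ρ' hρ'
  · rintro ⟨-, huniv⟩
    refine ⟨h, fun S ρ' hρ' => ?_⟩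
    simpa only [key S ρ' hρ'] using huniv S _ hρ'.isPseudoDeformation

end UniversalDeformation

theorem theorem2p2p2 {O : Type u} [CommRing O] [IsDomain O] [IsDiscreteValuationRing O]
    [IsAdicComplete (maximalIdeal O) O]
    {k : Type v} [Field k] [Algebra O k] (hk : Function.Surjective (algebraMap O k))
    (hchar : ringChar k ≠ 2)
    {P : Type p} [Group P] [Group.FG P]
    (ρbar : P →* Matrix.SpecialLinearGroup (Fin 2) k)
    (hρ : IsAbsolutelyIrreducibleSL2 ρbar) :
    IsPseudoSL2Rep (sl2Trace ρbar) ∧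
    (∃ (R : CompleteLocalAlg.{u, v, u} O k) (ρ : P →* Matrix.SpecialLinearGroup (Fin 2) R),
      IsUniversalSL2Deformation.{u, v, u, w', p} ρbar R ρ) ∧
    (∀ (R : CompleteLocalAlg.{u, v, w} O k) (ρ : P →* Matrix.SpecialLinearGroup (Fin 2) R),
      IsUniversalSL2Deformation.{u, v, w, w', p} ρbar R ρ →
        IsUniversalPseudoDeformation.{u, v, w, w', p} (sl2Trace ρbar) R (sl2Trace ρ)) ∧
    (∀ (R : CompleteLocalAlg.{u, v, w} O k) (T : P → R),
      IsUniversalPseudoDeformation.{u, v, w, w', p} (sl2Trace ρbar) R T →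
        ∃ ρ : P →* Matrix.SpecialLinearGroup (Fin 2) R, sl2Trace ρ = T ∧
          IsUniversalSL2Deformation.{u, v, w, w', p} ρbar R ρ) := by
  have h2 : (2 : k) ≠ 0 := Ring.two_ne_zero hchar
  have h2O : IsUnit (2 : O) :=
    (isUnit_iff_of_surjective hk 2).mpr (by rwa [map_ofNat])
  have hT := isPseudoSL2Rep_sl2Trace ρbar
  refine ⟨hT, ?_, fun R ρ h => (h.1.isUniversal_iff h2 hρ).mp h, fun R T h => ?_⟩
  -- The universal pseudo-deformation is the trace of a deformation of `ρbar`, which is then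
  -- universal.
  · obtain ⟨R, T, h⟩ := exists_isUniversalPseudoDeformation.{u, v, w', p} hk h2O hT
    obtain ⟨ρ, rfl, hdef⟩ := h.1.exists_isSL2Deformation h2 hρ
    exact ⟨R, ρ, (hdef.isUniversal_iff h2 hρ).mpr h⟩
  · obtain ⟨ρ, rfl, hdef⟩ := h.1.exists_isSL2Deformation h2 hρ
    exact ⟨ρ, rfl, (hdef.isUniversal_iff h2 hρ).mpr h⟩
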